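/- Let $K\ge 2$ and $N\ge 1$ be integers and $r,\sigma>0$. For $\theta=(\theta_{k,1},\theta_{k,2})_{k=1}^K\in\mathbb R^{2K}$ put $r_k(\theta)=(\theta_{k,1}^2+\theta_{k,2}^2)^{1/2}$, and for $\alpha\in\mathbb R$ let $g(\alpha)\cdot\theta$ be the vector obtained from $\theta$ by applying, for each $k=1,\dots,K$, the matrix $\begin{pmatrix}\cos k\alpha&-\sin k\alpha\\ \sin k\alpha&\cos k\alpha\end{pmatrix}$ to $(\theta_{k,1},\theta_{k,2})$. Define the loss \[L(\theta,\theta')=\min_{\alpha\in[-\pi,\pi)}\|\theta-g(\alpha)\cdot\theta'\|^2\] and the parameter space \[\mathcal P(r)=\{\theta\in\mathbb R^{2K}: r_k(\theta)=r\text{ for all }k=1,\dots,K\}.\] For $\theta^*\in\mathbb R^{2K}$ let $\mathbb E_{\theta^*}$ denote the expectation over $N$ i.i.d. samples \[y^{(m)}=g(\alpha^{(m)})\cdot\theta^*+\sigma\varepsilon^{(m)},\qquad m=1,\dots,N,\] where $\alpha^{(m)}\sim\mathrm{Unif}([-\pi,\pi))$ and $\varepsilon^{(m)}\sim\mathcal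 N(0,I_{2K})$ are all independent. Then there is a universal constant $c>0$, not depending on $K,N,r,\sigma$, such that for all such $K,N,r,\sigma$ \[\inf_{\hat\theta}\ \sup_{\theta^*\in\mathcal P(r)}\mathbb E_{\theta^*}\big[L(\theta^*,\hat\theta)\big]\ \ge\ c\cdot\min\left(\max\left(\frac{K\sigma^2}{N},\ \frac{\sigma^6}{N r^4 e^{3Kr^2/(2\sigma^2)}}\right),\ Kr^2\right),\] where the infimum is over all (measurable) estimators $\hat\theta=\hat\theta(y^{(1)},\dots,y^{(N)})\in\mathbb R^{2K}$. -/

import Mathlib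

open MeasureTheory ProbabilityTheory

noncomputable section

namespace OrbitEstimation

/-- The space `ℝ^{2K}` of Fourier coefficient vectors with its Euclidean norm. The entry at
`(k, 0)` is the cosine coefficient and the entry at `(k, 1)` the sine coefficient of the
frequency `k + 1`, where `k : Fin K` runs through `0, …, K - 1`. -/
abbrev Coeff (K : ℕ) : Type := EuclideanSpace ℝ (Fin K × Fin 2)

/-- The action `θ ↦ g(α) · θ` of the rotation by the angle `α`: the coefficient pair of the
frequency `k + 1` is rotated by the angle `(k + 1) α`. -/
def rotate {K : ℕ} (α : ℝ) (θ : Coeff K) : Coeff K :=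
  WithLp.toLp 2 fun p : Fin K × Fin 2 =>
    (Matrix.mulVec
      !![Real.cos (((p.1 : ℕ) + 1 : ℝ) * α), -Real.sin (((p.1 : ℕ) + 1 : ℝ) * α);
         Real.sin (((p.1 : ℕ) + 1 : ℝ) * α), Real.cos (((p.1 : ℕ) + 1 : ℝ) * α)]
      ![θ (p.1, 0), θ (p.1, 1)]) p.2

/-- The magnitude `r_k(θ)` of the Fourier coefficient pair with index `k`. -/
def magnitude {K : ℕ} (θ : Coeff K) (k : Fin K) : ℝ :=
  Real.sqrt (θ (k, 0) ^ 2 + θ (k, 1) ^ 2)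

/-- The parameter space `𝒫(r)`: all Fourier magnitudes are equal to `r`. -/
def paramSpace (K : ℕ) (r : ℝ) : Set (Coeff K) :=
  {θ | ∀ k : Fin K, magnitude θ k = r}

/-- The rotation-invariant loss `L(θ, θ') = min_{α ∈ [-π, π)} ‖θ - g(α) · θ'‖²`. -/
def loss {K : ℕ} (θ θ' : Coeff K) : ℝ :=
  ⨅ α : Set.Ico (-Real.pi) Real.pi, ‖θ - rotate (α : ℝ) θ'‖ ^ 2

/-- The uniform distribution on `[-π, π)`. -/
def unifAngle : Measure ℝ := cond volume (Set.Ico (-Real.pi) Real.pi)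

/-- The law of one observation `y = g(α) · θ + σ ε`, where `α` is uniform on `[-π, π)` and
`ε` is an independent standard Gaussian vector in `ℝ^{2K}`. -/
def sampleLaw {K : ℕ} (σ : ℝ) (θ : Coeff K) : Measure (Coeff K) :=
  (unifAngle.prod (stdGaussian (Coeff K))).map
    fun p : ℝ × Coeff K => rotate p.1 θ + σ • p.2

lemma measurable_sample {K : ℕ} (σ : ℝ) (θ : Coeff K) :
    Measurable fun p : ℝ × Coeff K => rotate p.1 θ + σ • p.2 := by
  have h : Continuous fun α : ℝ => rotate α θ := by
    unfold rotate
    refine (PiLp.continuous_toLp 2 _).comp (continuous_pi ?_)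
    rintro ⟨k, j⟩
    fin_cases j <;> simp [Matrix.mulVec, dotProduct] <;> fun_prop
  exact ((h.comp continuous_fst).add (continuous_snd.const_smul σ)).measurable

instance : IsProbabilityMeasure unifAngle := by
  unfold unifAngle
  refine cond_isProbabilityMeasure_of_finite ?_ ?_ <;> simp [Real.volume_Ico, Real.pi_pos]

instance {K : ℕ} (σ : ℝ) (θ : Coeff K) : IsProbabilityMeasure (sampleLaw σ θ) :=
  Measure.isProbabilityMeasure_map (measurable_sample σ θ).aemeasurable

/-- The joint law of `N` independent observations `y⁽¹⁾, …, y⁽ᴺ⁾`. -/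
def dataLaw {K : ℕ} (N : ℕ) (σ : ℝ) (θ : Coeff K) : Measure (Fin N → Coeff K) :=
  Measure.pi fun _ => sampleLaw σ θ

/-- The risk `𝔼_θ[L(θ, θ̂)] ∈ [0, ∞]` of an estimator `θ̂`, a function of the `N` samples. -/
def risk {K : ℕ} (N : ℕ) (σ : ℝ) (est : (Fin N → Coeff K) → Coeff K) (θ : Coeff K) : ENNReal :=
  ∫⁻ y, ENNReal.ofReal (loss θ (est y)) ∂(dataLaw N σ θ)

/-- The minimax risk `inf_{θ̂} sup_{θ ∈ 𝒫(r)} 𝔼_θ[L(θ, θ̂)] ∈ [0, ∞]`, the infimum being over all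
measurable functions `θ̂` of the `N` samples. -/
def minimaxRisk (K N : ℕ) (σ r : ℝ) : ENNReal :=
  ⨅ est : {f : (Fin N → Coeff K) → Coeff K // Measurable f},
    ⨆ θ : paramSpace K r, risk N σ est.1 θ.1

end OrbitEstimation

end

noncomputable section

namespace OrbitEstimation

/-! ### Product measures with densities -/

/-! The proof is Assouad's method on a hypercube of signals of constant magnitude `r`: phases vanish
on the lower half of the frequencies and are 0 or η, independently, on the upper half. The lower
half pins the rotation, since an angle that moves the high frequencies moves the low ones by a
comparable total amount. Hence two vertices, rotated arbitrarily, stay at squared distance at least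
a constant times r²η² times their Hamming distance (`rotated_cube_separation`). An estimate is
projected to its nearest vertex, and `hypercube_lower_bound` yields risk of order K r² η²
(`le_minimaxRisk`), provided that adjacent vertices cannot be told apart from N samples. A
one-sample χ²-divergence of at most 1/(2N) suffices for that (`half_le_measure_add_measure_compl`).

The two terms of the maximum come from two χ² bounds, with t = r²/σ². By convexity the angle may be
revealed, which gives χ² of order tη² when tη² is small (`lintegral_obsDensity_sq_div_le`); η² of
order min(1, 1/(Nt)) then yields Kσ²/N. For t ≤ 1/2 averaging over the angle gains more
(`lintegral_obsDensity_sq_div_le_of_eq_off`): the mixture density is at least e^{-Kt/2}, so χ² ≤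
e^{Kt/2} ∫(p-q)², and in ∫(p-q)² the orders t and t² cancel by orthogonality of cosines, leaving
t³Kη²e^{Kt}. Taking η² of order min(1, 1/(NKt³e^{3Kt/2})) gives the second term. Whenever that term
is the larger one, t ≤ 1/2 is automatic. -/

lemma lintegral_pi_prod {ι : Type*} [Fintype ι] {X : ι → Type*} [∀ i, MeasurableSpace (X i)]
    (μ : ∀ i, Measure (X i)) [∀ i, IsProbabilityMeasure (μ i)] (f : ∀ i, X i → ENNReal)
    (hf : ∀ i, Measurable (f i)) :
    ∫⁻ x, ∏ i, f i (x i) ∂(Measure.pi μ) = ∏ i, ∫⁻ x, f i x ∂(μ i) := by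
  have h := lintegral_prod_eq_prod_lintegral_of_indepFun (μ := Measure.pi μ) Finset.univ
    (fun i x => f i (x i)) (iIndepFun_pi fun i => (hf i).aemeasurable)
    (fun i => (hf i).comp (measurable_pi_apply i))
  rw [h]
  refine Finset.prod_congr rfl fun i _ => ?_
  have hm := measurePreserving_eval μ i
  rw [← hm.map_eq, lintegral_map (hf i) (measurable_pi_apply i)]

lemma pi_withDensity {ι : Type*} [Fintype ι] {X : ι → Type*} [∀ i, MeasurableSpace (X i)]
    (μ : ∀ i, Measure (X i)) [∀ i, IsProbabilityMeasure (μ i)] (f : ∀ i, X i → ENNReal)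
    (hf : ∀ i, Measurable (f i)) [∀ i, SigmaFinite ((μ i).withDensity (f i))] :
    Measure.pi (fun i => (μ i).withDensity (f i)) =
      (Measure.pi μ).withDensity fun x => ∏ i, f i (x i) := by
  refine Measure.pi_eq fun s hs => ?_
  rw [withDensity_apply _ (MeasurableSet.univ_pi hs)]
  have h1 : ∀ x : (∀ i, X i), (Set.univ.pi s).indicator (fun x => ∏ i, f i (x i)) x =
      ∏ i, (s i).indicator (f i) (x i) := by
    intro x
    by_cases hx : x ∈ Set.univ.pi s
    · rw [Set.indicator_of_mem hx]
      refine Finset.prod_congr rfl fun i _ => ?_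
      rw [Set.indicator_of_mem (hx i trivial)]
    · rw [Set.indicator_of_notMem hx]
      simp only [Set.mem_univ_pi, not_forall] at hx
      obtain ⟨i, hi⟩ := hx
      exact (Finset.prod_eq_zero (Finset.mem_univ i) (Set.indicator_of_notMem hi _)).symm
  rw [← lintegral_indicator (MeasurableSet.univ_pi hs)]
  simp_rw [h1]
  rw [lintegral_pi_prod μ _ fun i => (hf i).indicator (hs i)]
  refine Finset.prod_congr rfl fun i _ => ?_
  rw [lintegral_indicator (hs i), withDensity_apply _ (hs i)]

/-! ### Shifts of the standard Gaussian measure -/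

lemma gaussianReal_eq_withDensity (c : ℝ) :
    gaussianReal c 1 =
      (gaussianReal 0 1).withDensity fun x => ENNReal.ofReal (Real.exp (c * x - c ^ 2 / 2)) := by
  rw [gaussianReal_of_var_ne_zero _ one_ne_zero, gaussianReal_of_var_ne_zero _ one_ne_zero,
    ← withDensity_mul _ (measurable_gaussianPDF 0 1) (by fun_prop)]
  congr 1
  ext x
  simp only [Pi.mul_apply, gaussianPDF, gaussianPDFReal]
  rw [← ENNReal.ofReal_mul (by positivity), mul_assoc _ _ (Real.exp (c * x - c ^ 2 / 2)),
    ← Real.exp_add]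
  congr 3
  push_cast
  ring

/-- Cameron–Martin formula, obtained coordinatewise from the one-dimensional Gaussian densities. -/
lemma stdGaussian_map_add_left {ι : Type*} [Fintype ι] (v : EuclideanSpace ℝ ι) :
    (stdGaussian (EuclideanSpace ℝ ι)).map (fun x => v + x) =
      (stdGaussian (EuclideanSpace ℝ ι)).withDensity
        fun x => ENNReal.ofReal (Real.exp (inner ℝ v x - ‖v‖ ^ 2 / 2)) := by
  have hsf : ∀ i, SigmaFinite ((gaussianReal 0 1).withDensity
      fun x => ENNReal.ofReal (Real.exp (v i * x - v i ^ 2 / 2))) := by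
    intro i
    rw [← gaussianReal_eq_withDensity]
    infer_instance
  have hpi : (Measure.pi fun _ : ι => gaussianReal 0 1).map (fun x i => v i + x i) =
      (Measure.pi fun _ : ι => gaussianReal 0 1).withDensity
        fun x => ∏ i, ENNReal.ofReal (Real.exp (v i * x i - v i ^ 2 / 2)) := by
    rw [← pi_withDensity (fun _ : ι => gaussianReal 0 1)
      (fun i x => ENNReal.ofReal (Real.exp (v i * x - v i ^ 2 / 2))) (fun i => by fun_prop)]
    simp_rw [← gaussianReal_eq_withDensity]
    rw [Measure.pi_map_pi (f := fun i x => v i + x) fun i => by fun_prop]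
    congr 1
    ext1 i
    rw [gaussianReal_map_const_add, zero_add]
  rw [← map_pi_eq_stdGaussian, Measure.map_map (by fun_prop) (by fun_prop)]
  have hcomp : (fun x => v + x) ∘ (WithLp.toLp 2 : (ι → ℝ) → EuclideanSpace ℝ ι) =
      WithLp.toLp 2 ∘ fun x i => v i + x i := by
    ext x i
    simp
  rw [hcomp, ← Measure.map_map (by fun_prop) (by fun_prop), hpi]
  ext s hs
  rw [Measure.map_apply (by fun_prop) hs, withDensity_apply _ hs,
    withDensity_apply _ (hs.preimage (by fun_prop)), setLIntegral_map hs (by fun_prop) (by fun_prop)]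
  refine lintegral_congr fun x => ?_
  rw [← ENNReal.ofReal_prod_of_nonneg fun i _ => (Real.exp_pos _).le, ← Real.exp_sum]
  congr 2
  rw [Finset.sum_sub_distrib, EuclideanSpace.real_norm_sq_eq, Finset.sum_div]
  simp [PiLp.inner_apply, mul_comm]

/-- The shifted measure in `stdGaussian_map_add_left` has total mass 1, which is this identity up to
a constant factor. -/
lemma lintegral_exp_inner_stdGaussian {ι : Type*} [Fintype ι] (v : EuclideanSpace ℝ ι) :
    ∫⁻ x, ENNReal.ofReal (Real.exp (inner ℝ v x)) ∂(stdGaussian (EuclideanSpace ℝ ι)) =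
      ENNReal.ofReal (Real.exp (‖v‖ ^ 2 / 2)) := by
  have h := congrArg (fun μ : Measure (EuclideanSpace ℝ ι) => μ Set.univ)
    (stdGaussian_map_add_left v)
  simp only [withDensity_apply _ MeasurableSet.univ, Measure.restrict_univ] at h
  rw [Measure.map_apply (by fun_prop) MeasurableSet.univ, Set.preimage_univ, measure_univ] at h
  have h2 : ∀ x : EuclideanSpace ℝ ι, ENNReal.ofReal (Real.exp (inner ℝ v x)) =
      ENNReal.ofReal (Real.exp (‖v‖ ^ 2 / 2)) *
        ENNReal.ofReal (Real.exp (inner ℝ v x - ‖v‖ ^ 2 / 2)) := by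
    intro x
    rw [← ENNReal.ofReal_mul (Real.exp_pos _).le, ← Real.exp_add]
    congr 2
    ring
  simp_rw [h2]
  rw [lintegral_const_mul _ (by fun_prop), ← h, mul_one]

/-! ### Testing between two product measures -/

lemma half_le_measure_add_measure_compl {Ω : Type*} [MeasurableSpace Ω] (γ : Measure Ω)
    [IsProbabilityMeasure γ] (n : ℕ) (hn : 1 ≤ n) (p q : Ω → ℝ) (hp : Measurable p)
    (hq : Measurable q) (hp0 : ∀ x, 0 < p x) (hq0 : ∀ x, 0 < q x)
    [IsProbabilityMeasure (γ.withDensity fun x => ENNReal.ofReal (p x))]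
    [IsProbabilityMeasure (γ.withDensity fun x => ENNReal.ofReal (q x))]
    (hpq : ∫⁻ x, ENNReal.ofReal (p x ^ 2 / q x) ∂γ ≤ ENNReal.ofReal (1 + 1 / (2 * n)))
    (A : Set (Fin n → Ω)) (hA : MeasurableSet A) :
    1 / 2 ≤ (Measure.pi fun _ : Fin n => γ.withDensity fun x => ENNReal.ofReal (q x)) A +
      (Measure.pi fun _ : Fin n => γ.withDensity fun x => ENNReal.ofReal (p x)) Aᶜ := by
  set P := Measure.pi fun _ : Fin n => γ.withDensity fun x => ENNReal.ofReal (p x) with hP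
  set Q := Measure.pi fun _ : Fin n => γ.withDensity fun x => ENNReal.ofReal (q x) with hQ
  have hPd : P = (Measure.pi fun _ : Fin n => γ).withDensity
      fun x => ENNReal.ofReal (∏ i, p (x i)) := by
    rw [hP, pi_withDensity (fun _ : Fin n => γ) _ fun _ => by fun_prop]
    congr 1
    ext x
    rw [ENNReal.ofReal_prod_of_nonneg fun i _ => (hp0 _).le]
  have hQd : Q = (Measure.pi fun _ : Fin n => γ).withDensity
      fun x => ENNReal.ofReal (∏ i, q (x i)) := by
    rw [hQ, pi_withDensity (fun _ : Fin n => γ) _ fun _ => by fun_prop]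
    congr 1
    ext x
    rw [ENNReal.ofReal_prod_of_nonneg fun i _ => (hq0 _).le]
  -- The quantity 1 + χ² is multiplicative over products: (1 + 1/(2n))^n ≤ e^{1/2} ≤ 2.
  have hchi : ∫⁻ x, ENNReal.ofReal (∏ i, p (x i) ^ 2 / q (x i))
      ∂(Measure.pi fun _ : Fin n => γ) ≤ 2 := by
    have : ∀ x : Fin n → Ω, ENNReal.ofReal (∏ i, p (x i) ^ 2 / q (x i)) =
        ∏ i, ENNReal.ofReal (p (x i) ^ 2 / q (x i)) := fun x =>
      ENNReal.ofReal_prod_of_nonneg fun i _ => by have := hq0 (x i); positivity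
    simp_rw [this]
    rw [lintegral_pi_prod (fun _ : Fin n => γ) (fun _ x => ENNReal.ofReal (p x ^ 2 / q x))
      fun _ => by fun_prop]
    rw [Finset.prod_const, Finset.card_univ, Fintype.card_fin]
    have hn' : (0 : ℝ) < n := by exact_mod_cast hn
    calc _ ≤ (ENNReal.ofReal (1 + 1 / (2 * n))) ^ n := by gcongr
      _ = ENNReal.ofReal ((1 + 1 / (2 * n)) ^ n) := (ENNReal.ofReal_pow (by positivity) n).symm
      _ ≤ ENNReal.ofReal 2 := by
        refine ENNReal.ofReal_le_ofReal ?_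
        have h1 : (1 + 1 / (2 * n : ℝ)) ≤ Real.exp (1 / (2 * n)) := by
          rw [add_comm]; exact Real.add_one_le_exp _
        have h2 : (1 + 1 / (2 * n : ℝ)) ^ n ≤ Real.exp (1 / 2) := by
          calc _ ≤ Real.exp (1 / (2 * n)) ^ n := by gcongr
            _ = Real.exp (1 / 2) := by rw [← Real.exp_nat_mul]; congr 1; field_simp
        refine h2.trans ?_
        have h3 : Real.exp (1 / 2) ^ 2 < 2 ^ 2 := by
          rw [← Real.exp_nat_mul]
          norm_num
          linarith [Real.exp_one_lt_d9]
        exact (lt_of_pow_lt_pow_left₀ 2 (by norm_num) h3).le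
      _ = 2 := by simp
  have hPA : P A ≤ 1 / 2 + Q A := by
    rw [hPd, hQd, withDensity_apply _ hA, withDensity_apply _ hA]
    -- Completing the square gives a ≤ a²/(4b) + b; the first term contributes at most 2/4 = 1/2.
    calc ∫⁻ x in A, ENNReal.ofReal (∏ i, p (x i)) ∂(Measure.pi fun _ : Fin n => γ)
        ≤ ∫⁻ x in A, ((1 / 4) * ENNReal.ofReal (∏ i, p (x i) ^ 2 / q (x i)) +
          ENNReal.ofReal (∏ i, q (x i))) ∂(Measure.pi fun _ : Fin n => γ) := by
          refine lintegral_mono fun x => ?_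
          have hq1 : 0 < ∏ i, q (x i) := Finset.prod_pos fun i _ => hq0 _
          have hp1 : 0 < ∏ i, p (x i) := Finset.prod_pos fun i _ => hp0 _
          have h4 : (1 / 4 : ENNReal) = ENNReal.ofReal (1 / 4) := by
            rw [ENNReal.ofReal_div_of_pos (by norm_num)]; simp
          rw [h4, ← ENNReal.ofReal_mul (by norm_num), ← ENNReal.ofReal_add _ hq1.le]
          · refine ENNReal.ofReal_le_ofReal ?_
            rw [Finset.prod_div_distrib, Finset.prod_pow]
            set a := ∏ i, p (x i)
            set b := ∏ i, q (x i)
            have : 1 / 4 * (a ^ 2 / b) + b - a = (a / 2 - b) ^ 2 / b := by field_simp; ring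
            have h5 : 0 ≤ (a / 2 - b) ^ 2 / b := by positivity
            linarith
          · rw [Finset.prod_div_distrib]
            have : 0 ≤ ∏ i, p (x i) ^ 2 := Finset.prod_nonneg fun i _ => sq_nonneg _
            positivity
      _ = (1 / 4) * ∫⁻ x in A, ENNReal.ofReal (∏ i, p (x i) ^ 2 / q (x i))
            ∂(Measure.pi fun _ : Fin n => γ) +
          ∫⁻ x in A, ENNReal.ofReal (∏ i, q (x i)) ∂(Measure.pi fun _ : Fin n => γ) := by
          rw [lintegral_add_right _ (by fun_prop), lintegral_const_mul _ (by fun_prop)]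
      _ ≤ (1 / 4) * 2 + _ := by
          gcongr
          exact (setLIntegral_le_lintegral _ _).trans hchi
      _ = _ := by
          congr 1
          rw [show (1 / 4 : ENNReal) = ENNReal.ofReal (1 / 4) by
              rw [ENNReal.ofReal_div_of_pos (by norm_num)]; simp,
            show (2 : ENNReal) = ENNReal.ofReal 2 by simp, ← ENNReal.ofReal_mul (by norm_num),
            show (1 : ENNReal) = ENNReal.ofReal 1 by simp,
            ← ENNReal.ofReal_div_of_pos (by norm_num)]
          norm_num
  have h1 : (1 : ENNReal) ≤ 1 / 2 + (Q A + P Aᶜ) := by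
    rw [← add_assoc]
    calc (1 : ENNReal) = P A + P Aᶜ := by rw [measure_add_measure_compl hA, measure_univ]
      _ ≤ _ := by gcongr
  exact ENNReal.le_of_add_le_add_left (a := 1 / 2) (by simp) ((ENNReal.add_halves 1).trans_le h1)

/-! ### Averages over the uniform angle -/

lemma integrable_unifAngle {f : ℝ → ℝ} (hf : Continuous f) : Integrable f unifAngle := by
  have h : IntegrableOn f (Set.Ico (-Real.pi) Real.pi) volume :=
    (hf.integrableOn_Icc (a := -Real.pi) (b := Real.pi)).mono_set Set.Ico_subset_Icc_self
  unfold unifAngle ProbabilityTheory.cond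
  refine Integrable.smul_measure h ?_
  rw [Real.volume_Ico]
  simp [Real.pi_pos]

lemma integral_unifAngle (f : ℝ → ℝ) :
    ∫ α, f α ∂unifAngle = (2 * Real.pi)⁻¹ * ∫ α in (-Real.pi)..Real.pi, f α := by
  unfold unifAngle ProbabilityTheory.cond
  rw [integral_smul_measure, Real.volume_Ico,
    intervalIntegral.integral_of_le (by linarith [Real.pi_pos]),
    MeasureTheory.integral_Ico_eq_integral_Ioo, MeasureTheory.integral_Ioc_eq_integral_Ioo,
    smul_eq_mul]
  congr 1
  rw [ENNReal.toReal_inv, ENNReal.toReal_ofReal (by linarith [Real.pi_pos])]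
  ring

lemma integral_unifAngle_add {f : ℝ → ℝ} (hf : Function.Periodic f (2 * Real.pi)) (c : ℝ) :
    ∫ α, f (α + c) ∂unifAngle = ∫ α, f α ∂unifAngle := by
  rw [integral_unifAngle, integral_unifAngle, intervalIntegral.integral_comp_add_right]
  congr 1
  have := hf.intervalIntegral_add_eq (-Real.pi + c) (-Real.pi)
  rw [show Real.pi + c = -Real.pi + c + 2 * Real.pi by ring, this]
  congr 1
  ring

lemma periodic_comp_natCast_mul {f : ℝ → ℝ} (hf : Function.Periodic f (2 * Real.pi)) (k : ℕ) :
    Function.Periodic (fun α => f (k * α)) (2 * Real.pi) := by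
  intro α
  change f (k * (α + 2 * Real.pi)) = f (k * α)
  rw [mul_add]
  exact hf.nat_mul k _

lemma integral_unifAngle_cos {k : ℕ} (hk : k ≠ 0) (c : ℝ) :
    ∫ α, Real.cos (k * α + c) ∂unifAngle = 0 := by
  have hk' : (k : ℝ) ≠ 0 := by exact_mod_cast hk
  rw [integral_unifAngle, intervalIntegral.integral_comp_mul_add _ hk', integral_cos]
  have h1 : (k : ℝ) * Real.pi + c = k * -Real.pi + c + k * (2 * Real.pi) := by ring
  rw [h1, Real.sin_add_nat_mul_two_pi]
  simp

lemma integral_unifAngle_cos_sub_cos {k l : ℕ} (hkl : k ≠ l) :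
    ∫ α, Real.cos (((k : ℝ) - l) * α) ∂unifAngle = 0 := by
  rcases Nat.lt_or_gt_of_ne hkl with h | h
  · have := integral_unifAngle_cos (k := l - k) (by omega) 0
    rw [← this]
    congr 1
    ext α
    rw [Nat.cast_sub h.le, ← Real.cos_neg]
    congr 1
    ring
  · have := integral_unifAngle_cos (k := k - l) (by omega) 0
    rw [← this]
    congr 1
    ext α
    rw [Nat.cast_sub h.le, add_zero]

lemma integral_unifAngle_cos_mul_cos {k l : ℕ} (hkl : k ≠ l) :
    ∫ α, Real.cos (k * α) * Real.cos (l * α) ∂unifAngle = 0 := by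
  have h : ∀ α : ℝ, Real.cos (k * α) * Real.cos (l * α) =
      1 / 2 * Real.cos (((k : ℝ) - l) * α) + 1 / 2 * Real.cos ((k + l : ℕ) * α + 0) := by
    intro α
    push_cast
    rw [add_zero, sub_mul, add_mul, Real.cos_sub, Real.cos_add]
    ring
  simp_rw [h]
  rw [integral_add (integrable_unifAngle (by fun_prop)) (integrable_unifAngle (by fun_prop)),
    integral_const_mul, integral_const_mul, integral_unifAngle_cos_sub_cos hkl,
    integral_unifAngle_cos (by omega)]
  simp

/-! ### Signals with constant magnitudes -/

/-- The coefficient vector with all magnitudes `s` and phases `φ`. -/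
def signal {K : ℕ} (s : ℝ) (φ : Fin K → ℝ) : Coeff K :=
  WithLp.toLp 2 fun p => ![s * Real.cos (φ p.1), s * Real.sin (φ p.1)] p.2

/-- The phases of a rotated signal. -/
def rotatePhase {K : ℕ} (α : ℝ) (φ : Fin K → ℝ) : Fin K → ℝ :=
  fun k => φ k + ((k : ℕ) + 1 : ℝ) * α

variable {K : ℕ}

lemma rotate_signal (α s : ℝ) (φ : Fin K → ℝ) :
    rotate α (signal s φ) = signal s (rotatePhase α φ) := by
  ext ⟨k, j⟩
  fin_cases j
  · simp [rotate, signal, rotatePhase, Matrix.mulVec, dotProduct, Real.cos_add]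
    ring
  · simp [rotate, signal, rotatePhase, Matrix.mulVec, dotProduct, Real.sin_add]
    ring

lemma inner_signal (s : ℝ) (φ ψ : Fin K → ℝ) :
    inner ℝ (signal s φ) (signal s ψ) = s ^ 2 * ∑ k, Real.cos (φ k - ψ k) := by
  simp only [PiLp.inner_apply, signal, Fintype.sum_prod_type, Fin.sum_univ_two, Finset.mul_sum]
  refine Finset.sum_congr rfl fun k _ => ?_
  simp [Real.cos_sub]
  ring

lemma norm_signal_sq (s : ℝ) (φ : Fin K → ℝ) : ‖signal s φ‖ ^ 2 = K * s ^ 2 := by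
  rw [← real_inner_self_eq_norm_sq, inner_signal]
  simp [mul_comm]

lemma norm_signal_sub_sq (s : ℝ) (φ ψ : Fin K → ℝ) :
    ‖signal s φ - signal s ψ‖ ^ 2 = s ^ 2 * ∑ k, (2 - 2 * Real.cos (φ k - ψ k)) := by
  rw [norm_sub_sq_real, inner_signal, norm_signal_sq, norm_signal_sq, Finset.sum_sub_distrib,
    ← Finset.mul_sum]
  simp
  ring

lemma smul_signal (c s : ℝ) (φ : Fin K → ℝ) : c • signal s φ = signal (c * s) φ := by
  ext ⟨k, j⟩
  fin_cases j <;> simp [signal] <;> ring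

lemma signal_mem_paramSpace {r : ℝ} (hr : 0 ≤ r) (φ : Fin K → ℝ) :
    signal r φ ∈ paramSpace K r := by
  intro k
  have h : (r * Real.cos (φ k)) ^ 2 + (r * Real.sin (φ k)) ^ 2 = r ^ 2 := by
    rw [mul_pow, mul_pow, ← mul_add, Real.cos_sq_add_sin_sq, mul_one]
  simp [magnitude, signal, h, Real.sqrt_sq hr]

lemma continuous_signal_rotatePhase (s : ℝ) (φ : Fin K → ℝ) :
    Continuous fun α => signal s (rotatePhase α φ) := by
  unfold signal rotatePhase
  refine (PiLp.continuous_toLp 2 _).comp (continuous_pi ?_)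
  rintro ⟨k, j⟩
  fin_cases j <;> simp <;> fun_prop

lemma rotatePhase_sub (α β : ℝ) (φ ψ : Fin K → ℝ) (k : Fin K) :
    rotatePhase α φ k - rotatePhase β ψ k = φ k - ψ k + ((k : ℕ) + 1 : ℝ) * (α - β) := by
  unfold rotatePhase
  ring

/-- All frequencies are at least 1, so every coordinate of a rotated signal has mean zero. Sines are
written as shifted cosines. -/
lemma integral_inner_signal (s : ℝ) (φ : Fin K → ℝ) (y : Coeff K) :
    ∫ α, inner ℝ (signal s (rotatePhase α φ)) y ∂unifAngle = 0 := by
  have h : ∀ α, inner ℝ (signal s (rotatePhase α φ)) y =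
      ∑ k : Fin K, (y (k, 0) * s * Real.cos ((k + 1 : ℕ) * α + φ k) +
        y (k, 1) * s * Real.cos ((k + 1 : ℕ) * α + (φ k - Real.pi / 2))) := by
    intro α
    simp only [PiLp.inner_apply, signal, Fintype.sum_prod_type, Fin.sum_univ_two]
    refine Finset.sum_congr rfl fun k _ => ?_
    rw [show ((k + 1 : ℕ) : ℝ) * α + (φ k - Real.pi / 2) =
      ((k + 1 : ℕ) : ℝ) * α + φ k - Real.pi / 2 by ring, Real.cos_sub_pi_div_two]
    simp [rotatePhase, add_comm]
    ring
  simp_rw [h]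
  rw [integral_finsetSum _ fun k _ => integrable_unifAngle (by fun_prop)]
  refine Finset.sum_eq_zero fun k _ => ?_
  rw [integral_add (integrable_unifAngle (by fun_prop)) (integrable_unifAngle (by fun_prop)),
    integral_const_mul, integral_const_mul, integral_unifAngle_cos (by omega),
    integral_unifAngle_cos (by omega)]
  simp

/-! ### The density of one observation -/

/-- The integrand of the density of `g(α) · θ + ε` with respect to the law of `ε`, for the signal
`θ` with magnitudes `s` and phases `φ`. -/
def shiftDensity (s : ℝ) (φ : Fin K → ℝ) (α : ℝ) (y : Coeff K) : ℝ :=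
  Real.exp (inner ℝ (signal s (rotatePhase α φ)) y - K * s ^ 2 / 2)

/-- The density of the law of `g(α) · θ + ε`, with `α` uniform, with respect to the law of `ε`. -/
def obsDensity (s : ℝ) (φ : Fin K → ℝ) (y : Coeff K) : ℝ :=
  ∫ α, shiftDensity s φ α y ∂unifAngle

lemma continuous_exp_inner {v : ℝ → Coeff K} (hv : Continuous v) (c : ℝ) :
    Continuous fun z : ℝ × Coeff K => Real.exp (inner ℝ (v z.1) z.2 - c) :=
  Real.continuous_exp.comp
    (((hv.comp continuous_fst).inner continuous_snd).sub continuous_const)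

lemma continuous_shiftDensity (s : ℝ) (φ : Fin K → ℝ) :
    Continuous fun z : ℝ × Coeff K => shiftDensity s φ z.1 z.2 :=
  continuous_exp_inner (continuous_signal_rotatePhase s φ) _

lemma continuous_shiftDensity_left (s : ℝ) (φ : Fin K → ℝ) (y : Coeff K) :
    Continuous fun α => shiftDensity s φ α y :=
  Real.continuous_exp.comp
    (((continuous_signal_rotatePhase s φ).inner continuous_const).sub continuous_const)

lemma shiftDensity_pos (s : ℝ) (φ : Fin K → ℝ) (α : ℝ) (y : Coeff K) :
    0 < shiftDensity s φ α y := Real.exp_pos _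

lemma measurable_obsDensity (s : ℝ) (φ : Fin K → ℝ) : Measurable (obsDensity s φ) :=
  ((continuous_shiftDensity s φ).stronglyMeasurable.integral_prod_left'
    (μ := unifAngle)).measurable

/-- Jensen's inequality through e^x ≥ 1 + x, whose linear part averages to zero. The bound is
uniform in `y`, so it can replace the denominator in a χ²-divergence. -/
lemma exp_le_obsDensity (s : ℝ) (φ : Fin K → ℝ) (y : Coeff K) :
    Real.exp (-(K * s ^ 2 / 2)) ≤ obsDensity s φ y := by
  have hc := continuous_signal_rotatePhase s φ
  have h1 : ∫ α, Real.exp (-(K * s ^ 2 / 2)) * (inner ℝ (signal s (rotatePhase α φ)) y + 1)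
      ∂unifAngle = Real.exp (-(K * s ^ 2 / 2)) := by
    rw [integral_const_mul, integral_add (integrable_unifAngle (by fun_prop))
      (integrable_const _), integral_inner_signal]
    simp
  rw [← h1]
  refine integral_mono (integrable_unifAngle (by fun_prop))
    (integrable_unifAngle (continuous_shiftDensity_left s φ y)) fun α => ?_
  unfold shiftDensity
  rw [sub_eq_add_neg, add_comm _ (-_), Real.exp_add]
  exact mul_le_mul_of_nonneg_left (Real.add_one_le_exp _) (Real.exp_pos _).le

lemma obsDensity_pos (s : ℝ) (φ : Fin K → ℝ) (y : Coeff K) : 0 < obsDensity s φ y :=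
  (Real.exp_pos _).trans_le (exp_le_obsDensity s φ y)

lemma ofReal_obsDensity (s : ℝ) (φ : Fin K → ℝ) (y : Coeff K) :
    ENNReal.ofReal (obsDensity s φ y) = ∫⁻ α, ENNReal.ofReal (shiftDensity s φ α y) ∂unifAngle :=
  ofReal_integral_eq_lintegral_ofReal (integrable_unifAngle (continuous_shiftDensity_left s φ y))
    (ae_of_all _ fun α => (shiftDensity_pos s φ α y).le)

lemma sampleLaw_one_signal (s : ℝ) (φ : Fin K → ℝ) :
    sampleLaw 1 (signal s φ) =
      (stdGaussian (Coeff K)).withDensity fun y => ENNReal.ofReal (obsDensity s φ y) := by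
  ext B hB
  unfold sampleLaw
  rw [Measure.map_apply (measurable_sample 1 _) hB,
    Measure.prod_apply (hB.preimage (measurable_sample 1 _)), withDensity_apply _ hB]
  simp_rw [ofReal_obsDensity]
  rw [lintegral_lintegral_swap]
  · refine lintegral_congr fun α => ?_
    have h := stdGaussian_map_add_left (signal s (rotatePhase α φ))
    have h2 := congrArg (fun μ : Measure (Coeff K) => μ B) h
    simp only at h2
    rw [Measure.map_apply (by fun_prop) hB, withDensity_apply _ hB] at h2
    simp only [norm_signal_sq] at h2
    rw [← rotate_signal] at h2
    simpa [Set.preimage, shiftDensity, rotate_signal] using h2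
  · have := (continuous_shiftDensity s φ).measurable
    exact (this.comp measurable_swap).ennreal_ofReal.aemeasurable

/-- Rescaling reduces everything to unit noise and the signal-to-noise ratio `r / σ`. -/
lemma sampleLaw_signal {σ : ℝ} (hσ : σ ≠ 0) (r : ℝ) (φ : Fin K → ℝ) :
    sampleLaw σ (signal r φ) = (sampleLaw 1 (signal (r / σ) φ)).map fun y => σ • y := by
  unfold sampleLaw
  rw [Measure.map_map (by fun_prop) (measurable_sample 1 _)]
  congr 1
  ext1 z
  simp only [Function.comp, one_smul, smul_add, rotate_signal, smul_signal]
  rw [mul_div_cancel₀ _ hσ]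

lemma lintegral_exp_shift (v : Coeff K) (c : ℝ) :
    ∫⁻ y, ENNReal.ofReal (Real.exp (inner ℝ v y - c)) ∂(stdGaussian (Coeff K)) =
      ENNReal.ofReal (Real.exp (‖v‖ ^ 2 / 2 - c)) := by
  simp_rw [sub_eq_add_neg, Real.exp_add, ENNReal.ofReal_mul (Real.exp_pos _).le]
  rw [lintegral_mul_const _ (by fun_prop), lintegral_exp_inner_stdGaussian]

/-- Joint convexity of (a, b) ↦ a²/b: mixing both families over the same angle cannot increase χ².
At a fixed angle only two shifted Gaussians are compared. -/
lemma lintegral_obsDensity_sq_div_le (s : ℝ) (φ ψ : Fin K → ℝ) :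
    ∫⁻ y, ENNReal.ofReal (obsDensity s φ y ^ 2 / obsDensity s ψ y) ∂(stdGaussian (Coeff K)) ≤
      ENNReal.ofReal (Real.exp (s ^ 2 * ∑ k, (2 - 2 * Real.cos (φ k - ψ k)))) := by
  have hcφ := continuous_signal_rotatePhase s φ
  have hcψ := continuous_signal_rotatePhase s ψ
  let F : ℝ → Coeff K → ℝ := fun α y => Real.exp (inner ℝ
    ((2 : ℝ) • signal s (rotatePhase α φ) - signal s (rotatePhase α ψ)) y - K * s ^ 2 / 2)
  have hv : Continuous fun α =>
      (2 : ℝ) • signal s (rotatePhase α φ) - signal s (rotatePhase α ψ) := by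
    fun_prop
  have hF : Continuous fun z : ℝ × Coeff K => F z.1 z.2 := continuous_exp_inner hv _
  have hFα : ∀ y, Integrable (fun α => F α y) unifAngle := fun y =>
    integrable_unifAngle
      (Real.continuous_exp.comp ((hv.inner continuous_const).sub continuous_const))
  have hFeq : ∀ α y, F α y = shiftDensity s φ α y ^ 2 / shiftDensity s ψ α y := by
    intro α y
    simp only [F, shiftDensity]
    rw [← Real.exp_nat_mul, ← Real.exp_sub, inner_sub_left, inner_smul_left]
    congr 1
    simp
    ring
  have hpt : ∀ y, obsDensity s φ y ^ 2 / obsDensity s ψ y ≤ ∫ α, F α y ∂unifAngle := by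
    intro y
    have hq := obsDensity_pos s ψ y
    -- For every l, 2la - l²b ≤ a²/b. This l makes the average of the left side equal to the
    -- quotient of the averages.
    set l := obsDensity s φ y / obsDensity s ψ y with hl
    have i1 := integrable_unifAngle (continuous_shiftDensity_left s φ y)
    have i2 := integrable_unifAngle (continuous_shiftDensity_left s ψ y)
    have h1 : ∫ α, (2 * l * shiftDensity s φ α y - l ^ 2 * shiftDensity s ψ α y) ∂unifAngle =
        obsDensity s φ y ^ 2 / obsDensity s ψ y := by
      rw [integral_sub (i1.const_mul _) (i2.const_mul _), integral_const_mul, integral_const_mul]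
      change 2 * l * obsDensity s φ y - l ^ 2 * obsDensity s ψ y = _
      rw [hl]
      field_simp
      ring
    rw [← h1]
    refine integral_mono ((i1.const_mul _).sub (i2.const_mul _)) (hFα y) fun α => ?_
    change 2 * l * shiftDensity s φ α y - l ^ 2 * shiftDensity s ψ α y ≤ F α y
    rw [hFeq]
    have hb := shiftDensity_pos s ψ α y
    set a := shiftDensity s φ α y
    set b := shiftDensity s ψ α y
    have h2 : a ^ 2 / b - (2 * l * a - l ^ 2 * b) = (a - l * b) ^ 2 / b := by
      field_simp
      ring
    have h3 : 0 ≤ (a - l * b) ^ 2 / b := by positivity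
    linarith
  calc _ ≤ ∫⁻ y, ∫⁻ α, ENNReal.ofReal (F α y) ∂unifAngle ∂(stdGaussian (Coeff K)) := by
        refine lintegral_mono fun y => ?_
        rw [← ofReal_integral_eq_lintegral_ofReal (hFα y) (ae_of_all _ fun α => (Real.exp_pos _).le)]
        exact ENNReal.ofReal_le_ofReal (hpt y)
    _ = ∫⁻ α, ∫⁻ y, ENNReal.ofReal (F α y) ∂(stdGaussian (Coeff K)) ∂unifAngle := by
        refine lintegral_lintegral_swap ?_
        exact (hF.measurable.comp measurable_swap).ennreal_ofReal.aemeasurable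
    _ = ∫⁻ α, ENNReal.ofReal (Real.exp (s ^ 2 * ∑ k, (2 - 2 * Real.cos (φ k - ψ k))))
          ∂unifAngle := by
        refine lintegral_congr fun α => ?_
        simp only [F]
        -- Both signals u, v have squared norm Ks², so ‖2u - v‖²/2 - Ks²/2 = ‖u - v‖².
        rw [lintegral_exp_shift, norm_sub_sq_real, norm_smul, mul_pow, inner_smul_left,
          norm_signal_sq, norm_signal_sq, inner_signal, Finset.sum_sub_distrib, ← Finset.mul_sum]
        simp only [rotatePhase_sub]
        congr 2
        simp
        ring
    _ = _ := by simp

/-! ### Perturbation of a single phase: the analytic estimate -/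

lemma abs_exp_sub_one_le_mul_exp (x : ℝ) : |Real.exp x - 1| ≤ |x| * Real.exp |x| := by
  have h := Complex.norm_exp_sub_sum_le_norm_mul_exp (x : ℂ) 1
  simp only [Finset.sum_range_one, pow_zero, Nat.factorial_zero, Nat.cast_one, div_one, pow_one,
    Complex.norm_real, Real.norm_eq_abs] at h
  rwa [← Complex.ofReal_exp, ← Complex.ofReal_one, ← Complex.ofReal_sub, Complex.norm_real,
    Real.norm_eq_abs] at h

lemma abs_exp_sub_one_sub_le_sq_mul_exp (x : ℝ) :
    |Real.exp x - 1 - x| ≤ x ^ 2 * Real.exp |x| := by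
  have h := Complex.norm_exp_sub_sum_le_norm_mul_exp (x : ℂ) 2
  simp only [Finset.sum_range_succ, Finset.sum_range_zero, pow_zero, Nat.factorial_zero,
    Nat.cast_one, div_one, pow_one, zero_add, Nat.factorial_one,
    Complex.norm_real, Real.norm_eq_abs, sq_abs] at h
  rwa [← Complex.ofReal_exp, ← Complex.ofReal_one, ← Complex.ofReal_add, ← Complex.ofReal_sub,
    Complex.norm_real, Real.norm_eq_abs, ← sub_sub] at h

/-- The symmetric second difference of `x ↦ exp (t cos x)` with step `η`. -/
def expCosDiff (t η x : ℝ) : ℝ :=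
  Real.exp (t * Real.cos (x + η)) + Real.exp (t * Real.cos (x - η)) -
    2 * Real.exp (t * Real.cos x)

lemma exp_half_le_two : Real.exp (1 / 2) ≤ 2 := by
  have h : Real.exp (1 / 2) ^ 2 < 2 ^ 2 := by
    rw [← Real.exp_nat_mul]
    norm_num
    linarith [Real.exp_one_lt_d9]
  exact (lt_of_pow_lt_pow_left₀ 2 (by norm_num) h).le

/-- The term linear in t is explicit because cos(x+η) + cos(x-η) - 2cos x is exactly -2(1 - cos
η)cos x. What remains is quadratic in both t and η. -/
lemma abs_expCosDiff_add_le {t : ℝ} (ht : 0 ≤ t) (ht' : t ≤ 1 / 2) (η x : ℝ) :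
    |expCosDiff t η x + t * (2 * (1 - Real.cos η)) * Real.cos x| ≤ 14 * t ^ 2 * η ^ 2 := by
  set a := Real.cos (x + η) with ha
  set b := Real.cos (x - η) with hb
  set c := Real.cos x with hc
  have hab : a + b - 2 * c = -(2 * (1 - Real.cos η)) * c := by
    rw [ha, hb, hc, Real.cos_add, Real.cos_sub]; ring
  have hδ : 2 * (1 - Real.cos η) ≤ η ^ 2 := by
    linarith [Real.one_sub_sq_div_two_le_cos (x := η)]
  have hδ0 : 0 ≤ 2 * (1 - Real.cos η) := by linarith [Real.cos_le_one η]
  have hc1 : |c| ≤ 1 := Real.abs_cos_le_one x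
  have ha1 : |a| ≤ 1 := Real.abs_cos_le_one _
  have hb1 : |b| ≤ 1 := Real.abs_cos_le_one _
  have hac : |a - c| ≤ |η| := by
    have := Real.abs_cos_sub_cos_le (x + η) x
    simpa using this
  have hbc : |b - c| ≤ |η| := by
    have := Real.abs_cos_sub_cos_le (x - η) x
    simpa using this
  have hec : Real.exp (t * c) ≤ 2 := by
    refine (Real.exp_le_exp.2 ?_).trans exp_half_le_two
    nlinarith [(abs_le.1 hc1).2]
  have he1 : |Real.exp (t * c) - 1| ≤ 2 * t := by
    have h := abs_exp_sub_one_le_mul_exp (t * c)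
    have h1 : |t * c| ≤ t := by
      rw [abs_mul, abs_of_nonneg ht]
      exact mul_le_of_le_one_right ht hc1
    calc _ ≤ |t * c| * Real.exp |t * c| := h
      _ ≤ t * 2 := by
        gcongr
        exact (Real.exp_le_exp.2 (h1.trans ht')).trans exp_half_le_two
      _ = 2 * t := mul_comm _ _
  have hR : ∀ u, |u| ≤ 1 → |u - c| ≤ |η| →
      |Real.exp (t * (u - c)) - 1 - t * (u - c)| ≤ 3 * t ^ 2 * η ^ 2 := by
    intro u hu huc
    have h := abs_exp_sub_one_sub_le_sq_mul_exp (t * (u - c))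
    have h1 : |t * (u - c)| ≤ 1 := by
      rw [abs_mul, abs_of_nonneg ht]
      have : |u - c| ≤ 2 := (abs_sub _ _).trans (by linarith)
      nlinarith [abs_nonneg (u - c)]
    have h2 : Real.exp |t * (u - c)| ≤ 3 :=
      (Real.exp_le_exp.2 h1).trans (by linarith [Real.exp_one_lt_d9])
    have h3 : (u - c) ^ 2 ≤ η ^ 2 := sq_le_sq.2 huc
    calc _ ≤ (t * (u - c)) ^ 2 * Real.exp |t * (u - c)| := h
      _ ≤ (t ^ 2 * η ^ 2) * 3 := by
        rw [mul_pow]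
        gcongr
      _ = _ := by ring
  have hRa := hR a ha1 hac
  have hRb := hR b hb1 hbc
  -- Factor out e^{tc} and expand both increments to first order. The prefactor error gives 2t²η²
  -- and the two Taylor remainders 2(3 + 3)t²η², hence 14.
  have hsplit : expCosDiff t η x + t * (2 * (1 - Real.cos η)) * c =
      (Real.exp (t * c) - 1) * (t * (-(2 * (1 - Real.cos η)) * c)) + Real.exp (t * c) *
        ((Real.exp (t * (a - c)) - 1 - t * (a - c)) +
          (Real.exp (t * (b - c)) - 1 - t * (b - c))) := by
    have e1 : Real.exp (t * a) = Real.exp (t * c) * Real.exp (t * (a - c)) := by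
      rw [← Real.exp_add]; congr 1; ring
    have e2 : Real.exp (t * b) = Real.exp (t * c) * Real.exp (t * (b - c)) := by
      rw [← Real.exp_add]; congr 1; ring
    unfold expCosDiff
    rw [← ha, ← hb, ← hc, e1, e2, ← hab]
    linear_combination t * hab
  rw [hsplit]
  calc _ ≤ |Real.exp (t * c) - 1| * (t * (2 * (1 - Real.cos η) * |c|)) + Real.exp (t * c) *
        (|Real.exp (t * (a - c)) - 1 - t * (a - c)| +
          |Real.exp (t * (b - c)) - 1 - t * (b - c)|) := by
        refine (abs_add_le _ _).trans ?_
        rw [abs_mul, abs_mul (Real.exp _), abs_mul t, abs_mul (-_), abs_neg, abs_of_nonneg ht,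
          abs_of_nonneg hδ0, abs_of_nonneg (Real.exp_pos _).le]
        gcongr
        exact abs_add_le _ _
    _ ≤ 2 * t * (t * (η ^ 2 * 1)) + 2 * (3 * t ^ 2 * η ^ 2 + 3 * t ^ 2 * η ^ 2) := by
        gcongr
    _ = _ := by ring

lemma abs_expCosDiff_le {t : ℝ} (ht : 0 ≤ t) (ht' : t ≤ 1 / 2) (η x : ℝ) :
    |expCosDiff t η x| ≤ 8 * t * η ^ 2 := by
  have h := abs_expCosDiff_add_le ht ht' η x
  have hδ : 2 * (1 - Real.cos η) ≤ η ^ 2 := by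
    linarith [Real.one_sub_sq_div_two_le_cos (x := η)]
  have hδ0 : 0 ≤ 2 * (1 - Real.cos η) := by linarith [Real.cos_le_one η]
  have h2 : |t * (2 * (1 - Real.cos η)) * Real.cos x| ≤ t * η ^ 2 := by
    rw [abs_mul, abs_of_nonneg (by positivity)]
    calc _ ≤ t * (2 * (1 - Real.cos η)) * 1 := by
          gcongr
          exact Real.abs_cos_le_one x
      _ ≤ t * η ^ 2 := by rw [mul_one]; gcongr
  have h3 : 14 * t ^ 2 * η ^ 2 ≤ 7 * t * η ^ 2 := by nlinarith [mul_nonneg ht (sq_nonneg η)]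
  have := abs_sub (expCosDiff t η x + t * (2 * (1 - Real.cos η)) * Real.cos x)
    (t * (2 * (1 - Real.cos η)) * Real.cos x)
  rw [add_sub_cancel_right] at this
  linarith

lemma continuous_expCosDiff (t η : ℝ) : Continuous (expCosDiff t η) := by
  unfold expCosDiff
  fun_prop

/-- The three terms are translates of one periodic function, with weights 1, 1 and -2. -/
lemma integral_expCosDiff (t η : ℝ) (k : ℕ) (hk : k ≠ 0) :
    ∫ α, expCosDiff t η (k * α) ∂unifAngle = 0 := by
  have hk' : (k : ℝ) ≠ 0 := by exact_mod_cast hk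
  have hper : Function.Periodic (fun α : ℝ => Real.exp (t * Real.cos (k * α))) (2 * Real.pi) :=
    periodic_comp_natCast_mul (f := fun x => Real.exp (t * Real.cos x))
      (fun x => by simp) k
  have h : ∀ c : ℝ, ∫ α, Real.exp (t * Real.cos (k * α + c)) ∂unifAngle =
      ∫ α, Real.exp (t * Real.cos (k * α)) ∂unifAngle := by
    intro c
    rw [← integral_unifAngle_add hper (c / k)]
    congr 1
    ext α
    rw [mul_add, mul_div_cancel₀ _ hk']
  unfold expCosDiff
  rw [integral_sub (integrable_unifAngle (by fun_prop))
    (integrable_unifAngle (by fun_prop)), integral_add (integrable_unifAngle (by fun_prop))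
    (integrable_unifAngle (by fun_prop)), integral_const_mul]
  simp_rw [sub_eq_add_neg (_ * _) η]
  rw [h, h]
  ring

/-- The Dirichlet-type kernel `∑ cos ((k + 1) α)` over all indices `k ≠ j`. -/
def puncturedKernel (j : Fin K) (α : ℝ) : ℝ :=
  ∑ k ∈ Finset.univ.erase j, Real.cos ((k + 1 : ℕ) * α)

lemma continuous_puncturedKernel (j : Fin K) : Continuous (puncturedKernel j) := by
  unfold puncturedKernel
  fun_prop

lemma abs_puncturedKernel_le (j : Fin K) (α : ℝ) : |puncturedKernel j α| ≤ K := by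
  unfold puncturedKernel
  calc _ ≤ ∑ k ∈ Finset.univ.erase j, |Real.cos ((k + 1 : ℕ) * α)| :=
        Finset.abs_sum_le_sum_abs _ _
    _ ≤ ∑ k ∈ (Finset.univ : Finset (Fin K)), (1 : ℝ) :=
        (Finset.sum_le_sum fun k _ => Real.abs_cos_le_one _).trans
          (Finset.sum_le_sum_of_subset_of_nonneg (Finset.subset_univ _)
            fun _ _ _ => zero_le_one)
    _ = K := by simp

/-- Orthogonality leaves only the diagonal terms. This saves a factor K over the pointwise bound K²
and keeps K to the first power in the χ² bound. -/
lemma integral_puncturedKernel_sq_le (j : Fin K) :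
    ∫ α, puncturedKernel j α ^ 2 ∂unifAngle ≤ K := by
  unfold puncturedKernel
  simp_rw [sq, Finset.sum_mul_sum]
  rw [integral_finsetSum _ fun k _ => integrable_unifAngle (by fun_prop)]
  calc _ ≤ ∑ k ∈ Finset.univ.erase j, (1 : ℝ) := by
        refine Finset.sum_le_sum fun k hk => ?_
        rw [integral_finsetSum _ fun k _ => integrable_unifAngle (by fun_prop)]
        rw [Finset.sum_eq_single_of_mem k hk fun l _ hl => integral_unifAngle_cos_mul_cos
          fun h => hl (Fin.ext (by omega))]
        calc _ ≤ ∫ _, (1 : ℝ) ∂unifAngle := by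
              refine integral_mono (integrable_unifAngle (by fun_prop)) (integrable_const _)
                fun α => ?_
              have := Real.cos_sq_le_one ((k + 1 : ℕ) * α)
              simpa [sq] using this
          _ = 1 := by simp
    _ ≤ ∑ k ∈ (Finset.univ : Finset (Fin K)), (1 : ℝ) :=
        Finset.sum_le_sum_of_subset_of_nonneg (Finset.subset_univ _) fun _ _ _ => zero_le_one
    _ = K := by simp

lemma integral_puncturedKernel_mul_cos (j : Fin K) :
    ∫ α, puncturedKernel j α * Real.cos ((j + 1 : ℕ) * α) ∂unifAngle = 0 := by
  unfold puncturedKernel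
  simp_rw [Finset.sum_mul]
  rw [integral_finsetSum _ fun k _ => integrable_unifAngle (by fun_prop)]
  refine Finset.sum_eq_zero fun k hk => integral_unifAngle_cos_mul_cos fun h => ?_
  exact Finset.ne_of_mem_erase hk (Fin.ext (by omega))

/-- The central cancellation. Expanding the exponential, the constant term integrates to zero
against `expCosDiff`, and the linear term is orthogonal to the leading part of `expCosDiff` because
the kernel omits frequency `j + 1`. Only order t³ survives. -/
lemma abs_integral_exp_mul_expCosDiff_le {t : ℝ} (ht : 0 ≤ t) (ht' : t ≤ 1 / 2) (η : ℝ)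
    (j : Fin K) :
    |∫ α, Real.exp (t * puncturedKernel j α) * expCosDiff t η ((j + 1 : ℕ) * α) ∂unifAngle| ≤
      22 * t ^ 3 * K * η ^ 2 * Real.exp (K * t) := by
  have cD := continuous_puncturedKernel j
  have cG : Continuous fun α : ℝ => expCosDiff t η ((j + 1 : ℕ) * α) :=
    (continuous_expCosDiff t η).comp (by fun_prop)
  set D := puncturedKernel j with hD
  set G := fun α : ℝ => expCosDiff t η ((j + 1 : ℕ) * α) with hG
  set κ := t * (2 * (1 - Real.cos η)) with hκ
  -- The last bracket integrates to zero. The first product is at most t²D²e^{Kt} · 8tη² and the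
  -- second at most Kt · 14t²η², whence 22 = 8 + 14.
  have hsplit : ∀ α, Real.exp (t * D α) * G α =
      ((Real.exp (t * D α) - 1 - t * D α) * G α +
        t * D α * (G α + κ * Real.cos ((j + 1 : ℕ) * α))) +
      (G α - t * κ * (D α * Real.cos ((j + 1 : ℕ) * α))) := by
    intro α; ring
  have hzero : ∫ α, (G α - t * κ * (D α * Real.cos ((j + 1 : ℕ) * α))) ∂unifAngle = 0 := by
    rw [integral_sub (integrable_unifAngle cG) (integrable_unifAngle (by fun_prop)),
      integral_const_mul, integral_puncturedKernel_mul_cos, hG,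
      integral_expCosDiff t η (j + 1) (by omega)]
    simp
  change |∫ α, Real.exp (t * D α) * G α ∂unifAngle| ≤ _
  simp_rw [hsplit]
  rw [integral_add (integrable_unifAngle (by fun_prop)) (integrable_unifAngle (by fun_prop)),
    hzero, add_zero]
  have hbound : ∀ α, |(Real.exp (t * D α) - 1 - t * D α) * G α +
        t * D α * (G α + κ * Real.cos ((j + 1 : ℕ) * α))| ≤
      8 * t ^ 3 * η ^ 2 * Real.exp (K * t) * D α ^ 2 + 14 * t ^ 3 * η ^ 2 * K := by
    intro α
    have hDK := abs_puncturedKernel_le j α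
    rw [← hD] at hDK
    have h1 := abs_exp_sub_one_sub_le_sq_mul_exp (t * D α)
    have h2 : |t * D α| ≤ K * t := by
      rw [abs_mul, abs_of_nonneg ht, mul_comm]
      gcongr
    have h3 : |G α| ≤ 8 * t * η ^ 2 := abs_expCosDiff_le ht ht' η _
    have h4 : |G α + κ * Real.cos ((j + 1 : ℕ) * α)| ≤ 14 * t ^ 2 * η ^ 2 :=
      abs_expCosDiff_add_le ht ht' η _
    calc _ ≤ |Real.exp (t * D α) - 1 - t * D α| * |G α| +
          |t * D α| * |G α + κ * Real.cos ((j + 1 : ℕ) * α)| := by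
          rw [← abs_mul, ← abs_mul]
          exact abs_add_le _ _
      _ ≤ ((t * D α) ^ 2 * Real.exp (K * t)) * (8 * t * η ^ 2) +
          (K * t) * (14 * t ^ 2 * η ^ 2) := by
          gcongr
          exact h1.trans (by gcongr)
      _ = _ := by ring
  calc _ ≤ ∫ α, |(Real.exp (t * D α) - 1 - t * D α) * G α +
        t * D α * (G α + κ * Real.cos ((j + 1 : ℕ) * α))| ∂unifAngle :=
        abs_integral_le_integral_abs
    _ ≤ ∫ α, (8 * t ^ 3 * η ^ 2 * Real.exp (K * t) * D α ^ 2 + 14 * t ^ 3 * η ^ 2 * K)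
          ∂unifAngle :=
        integral_mono (integrable_unifAngle (by fun_prop)) (integrable_unifAngle (by fun_prop))
          hbound
    _ = 8 * t ^ 3 * η ^ 2 * Real.exp (K * t) * ∫ α, D α ^ 2 ∂unifAngle +
          14 * t ^ 3 * η ^ 2 * K := by
        rw [integral_add (integrable_unifAngle (by fun_prop)) (integrable_const _),
          integral_const_mul]
        simp
    _ ≤ 8 * t ^ 3 * η ^ 2 * Real.exp (K * t) * K + 14 * t ^ 3 * η ^ 2 * K * Real.exp (K * t) := by
        refine add_le_add ?_ ?_
        · gcongr
          exact integral_puncturedKernel_sq_le j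
        · refine le_mul_of_one_le_right (by positivity) (Real.one_le_exp (by positivity))
    _ = _ := by ring

/-! ### Inner products of densities -/

/-- The Gaussian integral of two shift densities is the exponential of the inner product of the
shifts, a function of the difference of the two angles. By periodicity one of the two angular
averages is then redundant. -/
lemma lintegral_obsDensity_mul (s : ℝ) (φ ψ : Fin K → ℝ) :
    ∫⁻ y, ENNReal.ofReal (obsDensity s φ y * obsDensity s ψ y) ∂(stdGaussian (Coeff K)) =
      ENNReal.ofReal (∫ α, Real.exp (s ^ 2 * ∑ k : Fin K,
        Real.cos (φ k - ψ k + (k + 1 : ℕ) * α)) ∂unifAngle) := by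
  let f : ℝ → ℝ := fun α => Real.exp (s ^ 2 * ∑ k : Fin K,
    Real.cos (φ k - ψ k + (k + 1 : ℕ) * α))
  have hf : Continuous f := by
    change Continuous fun α : ℝ => Real.exp (s ^ 2 * ∑ k : Fin K,
      Real.cos (φ k - ψ k + (k + 1 : ℕ) * α))
    fun_prop
  have hper : Function.Periodic f (2 * Real.pi) := by
    intro α
    simp only [f]
    congr 2
    refine Finset.sum_congr rfl fun k _ => ?_
    rw [mul_add, ← add_assoc, Real.cos_add_nat_mul_two_pi]
  have hprod : ∀ α β, ∫⁻ y, ENNReal.ofReal (shiftDensity s φ α y) *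
      ENNReal.ofReal (shiftDensity s ψ β y) ∂(stdGaussian (Coeff K)) =
      ENNReal.ofReal (f (α + -β)) := by
    intro α β
    have h : ∀ y, ENNReal.ofReal (shiftDensity s φ α y) * ENNReal.ofReal (shiftDensity s ψ β y) =
        ENNReal.ofReal (Real.exp (inner ℝ (signal s (rotatePhase α φ) +
          signal s (rotatePhase β ψ)) y - K * s ^ 2)) := by
      intro y
      rw [← ENNReal.ofReal_mul (shiftDensity_pos _ _ _ _).le]
      unfold shiftDensity
      rw [← Real.exp_add, inner_add_left]
      congr 2
      ring
    simp_rw [h]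
    rw [lintegral_exp_shift, norm_add_sq_real, norm_signal_sq, norm_signal_sq, inner_signal]
    simp only [rotatePhase_sub, f]
    congr 2
    push_cast
    simp only [← sub_eq_add_neg]
    ring
  have hmφ : Measurable fun z : ℝ × Coeff K => ENNReal.ofReal (shiftDensity s φ z.1 z.2) :=
    (continuous_shiftDensity s φ).measurable.ennreal_ofReal
  have hmψ : Measurable fun z : ℝ × Coeff K => ENNReal.ofReal (shiftDensity s ψ z.1 z.2) :=
    (continuous_shiftDensity s ψ).measurable.ennreal_ofReal
  have hmφ' : ∀ y, Measurable fun α => ENNReal.ofReal (shiftDensity s φ α y) := fun y =>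
    (continuous_shiftDensity_left s φ y).measurable.ennreal_ofReal
  have hmψ' : ∀ y, Measurable fun α => ENNReal.ofReal (shiftDensity s ψ α y) := fun y =>
    (continuous_shiftDensity_left s ψ y).measurable.ennreal_ofReal
  calc _ = ∫⁻ y, ∫⁻ β, ∫⁻ α, ENNReal.ofReal (shiftDensity s φ α y) *
          ENNReal.ofReal (shiftDensity s ψ β y) ∂unifAngle ∂unifAngle ∂(stdGaussian (Coeff K)) := by
        refine lintegral_congr fun y => ?_
        rw [ENNReal.ofReal_mul (obsDensity_pos s φ y).le, ofReal_obsDensity, ofReal_obsDensity,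
          ← lintegral_const_mul _ (hmψ' y)]
        refine lintegral_congr fun β => ?_
        rw [lintegral_mul_const _ (hmφ' y)]
    _ = ∫⁻ β, ∫⁻ y, ∫⁻ α, ENNReal.ofReal (shiftDensity s φ α y) *
          ENNReal.ofReal (shiftDensity s ψ β y) ∂unifAngle ∂(stdGaussian (Coeff K)) ∂unifAngle := by
        refine lintegral_lintegral_swap (Measurable.aemeasurable ?_)
        have h1 : Measurable fun z : (Coeff K × ℝ) × ℝ =>
            ENNReal.ofReal (shiftDensity s φ z.2 z.1.1) :=
          hmφ.comp (f := fun z : (Coeff K × ℝ) × ℝ => (z.2, z.1.1)) (by fun_prop)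
        have h2 : Measurable fun z : (Coeff K × ℝ) × ℝ =>
            ENNReal.ofReal (shiftDensity s ψ z.1.2 z.1.1) :=
          hmψ.comp (f := fun z : (Coeff K × ℝ) × ℝ => (z.1.2, z.1.1)) (by fun_prop)
        exact (h1.mul h2).lintegral_prod_right'
    _ = ∫⁻ β, ∫⁻ α, ENNReal.ofReal (f (α + -β)) ∂unifAngle ∂unifAngle := by
        refine lintegral_congr fun β => ?_
        rw [lintegral_lintegral_swap]
        · exact lintegral_congr fun α => hprod α β
        · have h1 : Measurable fun z : Coeff K × ℝ => ENNReal.ofReal (shiftDensity s φ z.2 z.1) :=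
            hmφ.comp (f := fun z : Coeff K × ℝ => (z.2, z.1)) (by fun_prop)
          have h2 : Measurable fun z : Coeff K × ℝ => ENNReal.ofReal (shiftDensity s ψ β z.1) :=
            hmψ.comp (f := fun z : Coeff K × ℝ => (β, z.1)) (by fun_prop)
          exact (h1.mul h2).aemeasurable
    _ = ∫⁻ _, ENNReal.ofReal (∫ α, f α ∂unifAngle) ∂unifAngle := by
        refine lintegral_congr fun β => ?_
        rw [← integral_unifAngle_add hper (-β), ofReal_integral_eq_lintegral_ofReal]
        · exact integrable_unifAngle (by fun_prop)
        · exact ae_of_all _ fun α => (Real.exp_pos _).le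
    _ = _ := by simp [f]

lemma integrable_obsDensity_mul (s : ℝ) (φ ψ : Fin K → ℝ) :
    Integrable (fun y => obsDensity s φ y * obsDensity s ψ y) (stdGaussian (Coeff K)) := by
  refine ⟨((measurable_obsDensity s φ).mul (measurable_obsDensity s ψ)).aestronglyMeasurable, ?_⟩
  rw [hasFiniteIntegral_iff_ofReal (ae_of_all _ fun y =>
    (mul_pos (obsDensity_pos s φ y) (obsDensity_pos s ψ y)).le), lintegral_obsDensity_mul]
  exact ENNReal.ofReal_lt_top

lemma integral_obsDensity_mul (s : ℝ) (φ ψ : Fin K → ℝ) :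
    ∫ y, obsDensity s φ y * obsDensity s ψ y ∂(stdGaussian (Coeff K)) =
      ∫ α, Real.exp (s ^ 2 * ∑ k : Fin K, Real.cos (φ k - ψ k + (k + 1 : ℕ) * α)) ∂unifAngle := by
  rw [integral_eq_lintegral_of_nonneg_ae (ae_of_all _ fun y =>
    (mul_pos (obsDensity_pos s φ y) (obsDensity_pos s ψ y)).le)
    (integrable_obsDensity_mul s φ ψ).1, lintegral_obsDensity_mul,
    ENNReal.toReal_ofReal (integral_nonneg fun α => (Real.exp_pos _).le)]

instance (s : ℝ) (φ : Fin K → ℝ) : IsProbabilityMeasure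
    ((stdGaussian (Coeff K)).withDensity fun y => ENNReal.ofReal (obsDensity s φ y)) := by
  rw [← sampleLaw_one_signal]
  infer_instance

lemma lintegral_obsDensity (s : ℝ) (φ : Fin K → ℝ) :
    ∫⁻ y, ENNReal.ofReal (obsDensity s φ y) ∂(stdGaussian (Coeff K)) = 1 := by
  have h : ((stdGaussian (Coeff K)).withDensity fun y => ENNReal.ofReal (obsDensity s φ y))
    Set.univ = 1 := measure_univ
  rwa [withDensity_apply _ MeasurableSet.univ, Measure.restrict_univ] at h

lemma integrable_obsDensity (s : ℝ) (φ : Fin K → ℝ) :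
    Integrable (obsDensity s φ) (stdGaussian (Coeff K)) := by
  refine ⟨(measurable_obsDensity s φ).aestronglyMeasurable, ?_⟩
  rw [hasFiniteIntegral_iff_ofReal (ae_of_all _ fun y => (obsDensity_pos s φ y).le),
    lintegral_obsDensity]
  exact ENNReal.one_lt_top

lemma integral_obsDensity (s : ℝ) (φ : Fin K → ℝ) :
    ∫ y, obsDensity s φ y ∂(stdGaussian (Coeff K)) = 1 := by
  rw [integral_eq_lintegral_of_nonneg_ae (ae_of_all _ fun y => (obsDensity_pos s φ y).le)
    (integrable_obsDensity s φ).1, lintegral_obsDensity, ENNReal.toReal_one]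

/-- In the expanded square all frequencies other than `j + 1` contribute a common factor. The
diagonal terms carry shift 0 and the cross terms shifts of opposite sign, which makes minus a second
difference. -/
lemma integral_obsDensity_sub_sq_eq (s : ℝ) {φ ψ : Fin K → ℝ} (j : Fin K)
    (h : ∀ k ≠ j, φ k = ψ k) :
    ∫ y, (obsDensity s φ y - obsDensity s ψ y) ^ 2 ∂(stdGaussian (Coeff K)) =
      -∫ α, Real.exp (s ^ 2 * puncturedKernel j α) *
        expCosDiff (s ^ 2) (φ j - ψ j) ((j + 1 : ℕ) * α) ∂unifAngle := by
  have hsum : ∀ (a b : Fin K → ℝ) (α : ℝ), (∀ k ≠ j, a k = b k) →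
      Real.exp (s ^ 2 * ∑ k : Fin K, Real.cos (a k - b k + (k + 1 : ℕ) * α)) =
      Real.exp (s ^ 2 * puncturedKernel j α) *
        Real.exp (s ^ 2 * Real.cos ((j + 1 : ℕ) * α + (a j - b j))) := by
    intro a b α hab
    rw [← Real.exp_add, ← mul_add, ← Finset.sum_erase_add _ _ (Finset.mem_univ j), puncturedKernel,
      add_comm (a j - b j)]
    congr 3
    refine Finset.sum_congr rfl fun k hk => ?_
    rw [hab k (Finset.ne_of_mem_erase hk), sub_self, zero_add]
  have h' : ∀ k ≠ j, ψ k = φ k := fun k hk => (h k hk).symm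
  have cD := continuous_puncturedKernel j
  have hexp : ∀ y, (obsDensity s φ y - obsDensity s ψ y) ^ 2 =
      (obsDensity s φ y * obsDensity s φ y + obsDensity s ψ y * obsDensity s ψ y) -
        (obsDensity s φ y * obsDensity s ψ y + obsDensity s ψ y * obsDensity s φ y) := by
    intro y; ring
  simp_rw [hexp]
  have i := fun a b => integrable_obsDensity_mul (K := K) s a b
  have i' : ∀ a b c d : Fin K → ℝ, Integrable (fun y => obsDensity s a y * obsDensity s b y +
      obsDensity s c y * obsDensity s d y) (stdGaussian (Coeff K)) :=
    fun a b c d => (i a b).add (i c d)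
  rw [integral_sub (i' φ φ ψ ψ) (i' φ ψ ψ φ), integral_add (i φ φ) (i ψ ψ),
    integral_add (i φ ψ) (i ψ φ)]
  simp only [integral_obsDensity_mul]
  have e1 := fun α => hsum φ φ α fun _ _ => rfl
  have e2 := fun α => hsum ψ ψ α fun _ _ => rfl
  have e3 := fun α => hsum φ ψ α h
  have e4 := fun α => hsum ψ φ α h'
  simp_rw [e1, e2, e3, e4]
  rw [← integral_add (integrable_unifAngle (by fun_prop)) (integrable_unifAngle (by fun_prop)),
    ← integral_add (integrable_unifAngle (by fun_prop)) (integrable_unifAngle (by fun_prop)),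
    ← integral_sub (integrable_unifAngle (by fun_prop)) (integrable_unifAngle (by fun_prop)),
    ← integral_neg]
  congr 1
  ext α
  rw [expCosDiff, sub_self, sub_self, add_zero,
    show ∀ x, x + (ψ j - φ j) = x - (φ j - ψ j) by intro x; ring]
  ring

/-- The exponent 3Ks²/2 is Ks²/2 from bounding the denominator below plus Ks² from the estimate of
∫(p-q)². -/
lemma lintegral_obsDensity_sq_div_le_of_eq_off {s : ℝ} (hs : s ^ 2 ≤ 1 / 2) {φ ψ : Fin K → ℝ}
    (j : Fin K) (h : ∀ k ≠ j, φ k = ψ k) :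
    ∫⁻ y, ENNReal.ofReal (obsDensity s φ y ^ 2 / obsDensity s ψ y) ∂(stdGaussian (Coeff K)) ≤
      ENNReal.ofReal (1 + 22 * s ^ 6 * K * (φ j - ψ j) ^ 2 *
        Real.exp (3 * K * s ^ 2 / 2)) := by
  have iφ := integrable_obsDensity s φ
  have iψ := integrable_obsDensity s ψ
  have isq : Integrable (fun y => (obsDensity s φ y - obsDensity s ψ y) ^ 2)
      (stdGaussian (Coeff K)) := by
    have hexp : ∀ y, (obsDensity s φ y - obsDensity s ψ y) ^ 2 =
        (obsDensity s φ y * obsDensity s φ y + obsDensity s ψ y * obsDensity s ψ y) -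
          2 * (obsDensity s φ y * obsDensity s ψ y) := by
      intro y; ring
    simp_rw [hexp]
    exact ((integrable_obsDensity_mul s φ φ).add (integrable_obsDensity_mul s ψ ψ)).sub
      ((integrable_obsDensity_mul s φ ψ).const_mul 2)
  set E := Real.exp (K * s ^ 2 / 2) with hE
  let F : Coeff K → ℝ := fun y =>
    (2 * obsDensity s φ y - obsDensity s ψ y) + E * (obsDensity s φ y - obsDensity s ψ y) ^ 2
  have i1 : Integrable (fun y => 2 * obsDensity s φ y - obsDensity s ψ y)
    (stdGaussian (Coeff K)) := (iφ.const_mul 2).sub iψ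
  have i2 : Integrable (fun y => E * (obsDensity s φ y - obsDensity s ψ y) ^ 2)
    (stdGaussian (Coeff K)) := isq.const_mul E
  have hF : Integrable F (stdGaussian (Coeff K)) := i1.add i2
  have hle : ∀ y, obsDensity s φ y ^ 2 / obsDensity s ψ y ≤ F y := by
    intro y
    have hq := obsDensity_pos s ψ y
    have hqE : 1 / obsDensity s ψ y ≤ E := by
      have h1 := exp_le_obsDensity s ψ y
      rw [Real.exp_neg] at h1
      rw [one_div]
      exact inv_le_of_inv_le₀ (Real.exp_pos _) h1
    simp only [F]
    set a := obsDensity s φ y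
    set b := obsDensity s ψ y
    -- The part 2a - b integrates to 1, so only the squared difference pays the factor 1/b ≤ `E`.
    have : a ^ 2 / b = (2 * a - b) + 1 / b * (a - b) ^ 2 := by field_simp; ring
    rw [this]
    gcongr
  have hint : ∫ y, F y ∂(stdGaussian (Coeff K)) ≤ 1 + 22 * s ^ 6 * K * (φ j - ψ j) ^ 2 *
        Real.exp (3 * K * s ^ 2 / 2) := by
    simp only [F]
    rw [integral_add i1 i2, integral_sub (iφ.const_mul 2) iψ, integral_const_mul,
      integral_const_mul, integral_obsDensity, integral_obsDensity,
      integral_obsDensity_sub_sq_eq s j h]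
    have h1 := abs_integral_exp_mul_expCosDiff_le (sq_nonneg s) hs (φ j - ψ j) j
    have h2 := (neg_le_abs _).trans h1
    calc _ ≤ 2 * 1 - 1 + E * (22 * (s ^ 2) ^ 3 * K * (φ j - ψ j) ^ 2 * Real.exp (K * s ^ 2)) := by
          gcongr
      _ = 1 + 22 * s ^ 6 * K * (φ j - ψ j) ^ 2 * (E * Real.exp (K * s ^ 2)) := by ring
      _ = _ := by
          rw [hE, ← Real.exp_add]
          congr 3
          ring
  refine le_trans ?_ (ENNReal.ofReal_le_ofReal hint)
  rw [ofReal_integral_eq_lintegral_ofReal hF (ae_of_all _ fun y => ?_)]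
  · exact lintegral_mono fun y => ENNReal.ofReal_le_ofReal (hle y)
  · refine le_trans ?_ (hle y)
    have := obsDensity_pos s ψ y
    positivity

/-! ### Separation of signals up to rotation -/

/-- Since 2 - 2cos z = |1 - e^{iz}|², this is the triangle inequality for chords, squared. -/
lemma two_sub_two_cos_add_le (x y : ℝ) :
    2 - 2 * Real.cos (x + y) ≤ 2 * (2 - 2 * Real.cos x) + 2 * (2 - 2 * Real.cos y) := by
  have h : ∀ z, 2 - 2 * Real.cos z = 4 * Real.sin (z / 2) ^ 2 := by
    intro z
    have := Real.cos_two_mul (z / 2)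
    rw [mul_div_cancel₀ z two_ne_zero] at this
    rw [this, Real.sin_sq]
    ring
  rw [h, h, h, add_div, Real.sin_add]
  have h1 := Real.sin_sq_add_cos_sq (x / 2)
  have h2 := Real.sin_sq_add_cos_sq (y / 2)
  set a := Real.sin (x / 2)
  set b := Real.cos (x / 2)
  set c := Real.sin (y / 2)
  set d := Real.cos (y / 2)
  have h3 : (a * d) ^ 2 ≤ a ^ 2 := by
    rw [mul_pow]; nlinarith [sq_nonneg a, sq_nonneg c]
  have h4 : (b * c) ^ 2 ≤ c ^ 2 := by
    rw [mul_pow]; nlinarith [sq_nonneg a, sq_nonneg c]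
  nlinarith [sq_nonneg (a * d - b * c)]

lemma two_sub_two_cos_nonneg (x : ℝ) : 0 ≤ 2 - 2 * Real.cos x := by
  linarith [Real.cos_le_one x]

/-- Why low frequencies control the rotation: each high frequency is a sum of low ones, and the
squared chords satisfy e(i+j) ≤ 2e(i) + 2e(j). -/
lemma sum_high_le_sum_low (m n : ℕ) (hn : n ≤ m) (a : ℝ) :
    ∑ i ∈ Finset.range n, (2 - 2 * Real.cos (((m + i : ℕ) + 1 : ℝ) * a)) ≤
      10 * ∑ i ∈ Finset.range m, (2 - 2 * Real.cos (((i : ℕ) + 1 : ℝ) * a)) := by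
  set e : ℕ → ℝ := fun i => 2 - 2 * Real.cos (i * a) with he
  have e0 : ∀ i, 0 ≤ e i := fun i => two_sub_two_cos_nonneg _
  have eadd : ∀ i j, e (i + j) ≤ 2 * e i + 2 * e j := by
    intro i j
    have := two_sub_two_cos_add_le (i * a) (j * a)
    simp only [he]
    push_cast
    rwa [add_mul]
  have esucc : ∀ i : ℕ, 2 - 2 * Real.cos (((i : ℕ) + 1 : ℝ) * a) = e (i + 1) := by
    intro i; simp [he]
  simp_rw [esucc]
  set S := ∑ i ∈ Finset.range m, e (i + 1) with hS
  have ezero : e 0 = 0 := by simp [he]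
  -- Average over the m decompositions m = (i+1) + (m-1-i).
  have hm : m * e m ≤ 4 * S := by
    have h1 : ∀ i ∈ Finset.range m, e m ≤ 2 * e (i + 1) + 2 * e (m - 1 - i) := by
      intro i hi
      have hi' := Finset.mem_range.1 hi
      have := eadd (i + 1) (m - 1 - i)
      rwa [show i + 1 + (m - 1 - i) = m by omega] at this
    have h2 := Finset.sum_le_sum h1
    rw [Finset.sum_add_distrib, ← Finset.mul_sum, ← Finset.mul_sum,
      Finset.sum_range_reflect (fun i => e i) m] at h2
    have h3 : ∑ i ∈ Finset.range m, e i ≤ S := by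
      have h4 : ∑ i ∈ Finset.range (m + 1), e i = S + e 0 := Finset.sum_range_succ' e m
      rw [Finset.sum_range_succ, ezero, add_zero] at h4
      linarith [e0 m]
    simp only [Finset.sum_const, Finset.card_range, nsmul_eq_mul] at h2
    linarith
  -- Each high frequency is m + (i+1); with n ≤ m this produces 10 = 2·4 + 2.
  have h1 : ∀ i ∈ Finset.range n, e (m + i + 1) ≤ 2 * e m + 2 * e (i + 1) :=
    fun i _ => eadd m (i + 1)
  have h2 := Finset.sum_le_sum h1
  rw [Finset.sum_add_distrib, ← Finset.mul_sum, ← Finset.mul_sum] at h2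
  have h3 : ∑ i ∈ Finset.range n, e (i + 1) ≤ S :=
    Finset.sum_le_sum_of_subset_of_nonneg (Finset.range_mono hn) fun i _ _ => e0 _
  have h4 : (n : ℝ) * e m ≤ m * e m := mul_le_mul_of_nonneg_right (by exact_mod_cast hn) (e0 m)
  simp only [Finset.sum_const, Finset.card_range, nsmul_eq_mul] at h2
  linarith

/-- The indices of the upper half of the frequencies. -/
def upperHalf (K : ℕ) : Finset (Fin K) := Finset.univ.filter fun k => (K + 1) / 2 ≤ (k : ℕ)

lemma sum_upperHalf (f : ℕ → ℝ) :
    ∑ k ∈ upperHalf K, f k = ∑ i ∈ Finset.range (K / 2), f ((K + 1) / 2 + i) := by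
  have h1 : ∑ k ∈ upperHalf K, f k = ∑ k : Fin K, if (K + 1) / 2 ≤ (k : ℕ) then f k else 0 := by
    rw [upperHalf, Finset.sum_filter]
  have h2 := Fin.sum_univ_eq_sum_range (fun i => if (K + 1) / 2 ≤ i then f i else 0) K
  have h3 : K = (K + 1) / 2 + K / 2 := by omega
  rw [h1, h2]
  conv_lhs => rw [h3, Finset.sum_range_add]
  rw [← h3, Finset.sum_eq_zero fun i hi => if_neg (by have := Finset.mem_range.1 hi; omega),
    zero_add]
  exact Finset.sum_congr rfl fun i _ => if_pos (by omega)

lemma card_upperHalf : (upperHalf K).card = K / 2 := by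
  have := sum_upperHalf (K := K) fun _ => 1
  simp only [Finset.sum_const, nsmul_eq_mul, mul_one, Finset.card_range] at this
  exact_mod_cast this

lemma sum_lowerHalf (f : ℕ → ℝ) :
    ∑ k ∈ (upperHalf K)ᶜ, f k = ∑ i ∈ Finset.range ((K + 1) / 2), f i := by
  have h1 := Finset.sum_add_sum_compl (upperHalf K) fun k => f k
  rw [sum_upperHalf, Fin.sum_univ_eq_sum_range f K] at h1
  have h3 : K = (K + 1) / 2 + K / 2 := by omega
  have h4 : ∑ i ∈ Finset.range K, f i = ∑ i ∈ Finset.range ((K + 1) / 2), f i +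
      ∑ i ∈ Finset.range (K / 2), f ((K + 1) / 2 + i) := by
    conv_lhs => rw [h3, Finset.sum_range_add]
  linarith

/-- Undoing the rotation on the upper half costs at most what `sum_high_le_sum_low` charges to the
lower half, where `d` vanishes and the rotation is seen unperturbed. -/
lemma sum_upperHalf_le_sum_rotated (d : Fin K → ℝ) (hd : ∀ k ∉ upperHalf K, d k = 0) (a : ℝ) :
    ∑ k ∈ upperHalf K, (2 - 2 * Real.cos (d k)) ≤
      22 * ∑ k, (2 - 2 * Real.cos (d k + ((k : ℕ) + 1 : ℝ) * a)) := by
  set g : ℕ → ℝ := fun i => 2 - 2 * Real.cos ((i + 1 : ℝ) * a) with hg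
  have hlow : ∑ k ∈ (upperHalf K)ᶜ, (2 - 2 * Real.cos (d k + ((k : ℕ) + 1 : ℝ) * a)) =
      ∑ i ∈ Finset.range ((K + 1) / 2), g i := by
    rw [← sum_lowerHalf]
    refine Finset.sum_congr rfl fun k hk => ?_
    rw [hd k (Finset.mem_compl.1 hk), zero_add]
  have hhigh : ∑ k ∈ upperHalf K, g k ≤ 10 * ∑ i ∈ Finset.range ((K + 1) / 2), g i := by
    rw [sum_upperHalf]
    -- The halves have ⌈K/2⌉ lower and ⌊K/2⌋ upper frequencies, so the lower one is never the
    -- smaller.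
    exact sum_high_le_sum_low _ _ (by omega) a
  have hpt : ∑ k ∈ upperHalf K, (2 - 2 * Real.cos (d k)) ≤ ∑ k ∈ upperHalf K,
      (2 * (2 - 2 * Real.cos (d k + ((k : ℕ) + 1 : ℝ) * a)) + 2 * g k) := by
    refine Finset.sum_le_sum fun k _ => ?_
    have := two_sub_two_cos_add_le (d k + ((k : ℕ) + 1 : ℝ) * a) (-(((k : ℕ) + 1 : ℝ) * a))
    rwa [add_neg_cancel_right, Real.cos_neg] at this
  rw [Finset.sum_add_distrib, ← Finset.mul_sum, ← Finset.mul_sum] at hpt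
  rw [← Finset.sum_add_sum_compl (upperHalf K), hlow]
  have h0 : 0 ≤ ∑ k ∈ upperHalf K, (2 - 2 * Real.cos (d k + ((k : ℕ) + 1 : ℝ) * a)) :=
    Finset.sum_nonneg fun k _ => two_sub_two_cos_nonneg _
  have h1 : 0 ≤ ∑ i ∈ Finset.range ((K + 1) / 2), g i :=
    Finset.sum_nonneg fun k _ => two_sub_two_cos_nonneg _
  linarith

/-! ### The rotation-invariant loss -/

lemma rotate_sub (α : ℝ) (θ θ' : Coeff K) : rotate α (θ - θ') = rotate α θ - rotate α θ' := by
  ext ⟨k, j⟩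
  fin_cases j <;> simp [rotate, Matrix.mulVec, dotProduct] <;> ring

lemma norm_rotate (α : ℝ) (θ : Coeff K) : ‖rotate α θ‖ = ‖θ‖ := by
  have h : ‖rotate α θ‖ ^ 2 = ‖θ‖ ^ 2 := by
    rw [EuclideanSpace.real_norm_sq_eq, EuclideanSpace.real_norm_sq_eq, Fintype.sum_prod_type,
      Fintype.sum_prod_type]
    refine Finset.sum_congr rfl fun k _ => ?_
    have := Real.sin_sq_add_cos_sq (((k : ℕ) + 1 : ℝ) * α)
    simp [Fin.sum_univ_two, rotate, Matrix.mulVec, dotProduct]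
    linear_combination (θ (k, 0) ^ 2 + θ (k, 1) ^ 2) * this
  exact (sq_eq_sq₀ (norm_nonneg _) (norm_nonneg _)).1 h

lemma rotate_neg_rotate (α : ℝ) (θ : Coeff K) : rotate (-α) (rotate α θ) = θ := by
  ext ⟨k, j⟩
  have := Real.sin_sq_add_cos_sq (((k : ℕ) + 1 : ℝ) * α)
  fin_cases j
  · simp [rotate, Matrix.mulVec, dotProduct]
    linear_combination θ (k, 0) * this
  · simp [rotate, Matrix.mulVec, dotProduct]
    linear_combination θ (k, 1) * this

instance : Nonempty (Set.Ico (-Real.pi) Real.pi) :=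
  ⟨⟨0, by simp [Real.pi_pos.le], Real.pi_pos⟩⟩

lemma bddBelow_loss (θ θ' : Coeff K) :
    BddBelow (Set.range fun α : Set.Ico (-Real.pi) Real.pi => ‖θ - rotate (α : ℝ) θ'‖ ^ 2) :=
  ⟨0, by rintro _ ⟨α, rfl⟩; positivity⟩

lemma continuous_rotate (α : ℝ) : Continuous (rotate α : Coeff K → Coeff K) :=
  (LipschitzWith.of_dist_le_mul (K := 1) fun x y => by
    rw [dist_eq_norm, ← rotate_sub, norm_rotate, dist_eq_norm, NNReal.coe_one, one_mul]).continuous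

/-- The infimum runs over uncountably many angles; measurability comes from upper semicontinuity of
an infimum of continuous functions. -/
lemma measurable_loss (θ : Coeff K) : Measurable (loss θ) := by
  have h : UpperSemicontinuous (loss θ) := by
    refine upperSemicontinuous_ciInf (fun θ' => bddBelow_loss θ θ') fun α => ?_
    have := continuous_rotate (K := K) (α : ℝ)
    exact Continuous.upperSemicontinuous (by fun_prop)
  exact h.measurable

/-- If θ'' is at least as close to θ' as to θ, separation of their orbits forces θ'' away from θ:
the triangle inequality gives (a+b)² ≤ 2a² + 2b². The ε avoids showing that the infimum is attained.
-/
lemma le_four_mul_loss {θ θ' θ'' : Coeff K} {Δ : ℝ}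
    (hΔ : ∀ α β, Δ ≤ ‖rotate α θ - rotate β θ'‖ ^ 2) (h : loss θ' θ'' ≤ loss θ θ'') :
    Δ ≤ 4 * loss θ θ'' := by
  refine le_of_forall_pos_le_add fun ε hε => ?_
  have hlt : loss θ θ'' < loss θ θ'' + ε / 4 := by linarith
  obtain ⟨α, hα⟩ := exists_lt_of_ciInf_lt hlt
  obtain ⟨β, hβ⟩ := exists_lt_of_ciInf_lt (h.trans_lt hlt)
  have h1 := hΔ (-α) (-β)
  have h2 : rotate (-α) θ - rotate (-β) θ' =
      rotate (-α) (θ - rotate α θ'') - rotate (-β) (θ' - rotate β θ'') := by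
    rw [rotate_sub, rotate_sub, rotate_neg_rotate, rotate_neg_rotate]
    abel
  have h3 := norm_sub_le (rotate (-α) (θ - rotate α θ'')) (rotate (-β) (θ' - rotate β θ''))
  rw [← h2, norm_rotate, norm_rotate] at h3
  have h4 := norm_nonneg (rotate (-α) θ - rotate (-β) θ')
  nlinarith [sq_nonneg (‖θ - rotate α θ''‖ - ‖θ' - rotate β θ''‖)]

/-! ### Assouad's hypercube bound -/

/-- Makes the projection of an estimate to the nearest cube vertex measurable. -/
lemma exists_measurable_argmin {X T : Type*} [MeasurableSpace X] [MeasurableSpace T] [Fintype T]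
    [Nonempty T] (f : T → X → ℝ) (hf : ∀ t, Measurable (f t)) :
    ∃ g : X → T, Measurable g ∧ ∀ x t, f (g x) x ≤ f t x := by
  have key : ∀ S : Finset T, S.Nonempty → ∃ g : X → T, Measurable g ∧
      Measurable (fun x => f (g x) x) ∧ ∀ x, ∀ t ∈ S, f (g x) x ≤ f t x := by
    intro S hS
    induction hS using Finset.Nonempty.cons_induction with
    | singleton a => exact ⟨fun _ => a, measurable_const, hf a, by simp⟩
    | cons a S ha hS ih =>
      obtain ⟨g, hg, hfg, hmin⟩ := ih
      have hset : MeasurableSet {x | f a x ≤ f (g x) x} := measurableSet_le (hf a) hfg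
      classical
      refine ⟨fun x => if f a x ≤ f (g x) x then a else g x,
        Measurable.ite hset measurable_const hg, ?_, ?_⟩
      · have : (fun x => f (if f a x ≤ f (g x) x then a else g x) x) =
            fun x => if f a x ≤ f (g x) x then f a x else f (g x) x := by
          ext x; split_ifs <;> rfl
        rw [this]
        exact Measurable.ite hset (hf a) hfg
      · intro x t ht
        rw [Finset.mem_cons] at ht
        dsimp only
        split_ifs with hx
        · rcases ht with rfl | ht
          · exact le_rfl
          · exact hx.trans (hmin x t ht)
        · rcases ht with rfl | ht
          · exact (not_le.1 hx).le
          · exact hmin x t ht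
  obtain ⟨g, hg, -, hmin⟩ := key Finset.univ Finset.univ_nonempty
  exact ⟨g, hg, fun x t => hmin x t (Finset.mem_univ t)⟩

/-- Flip of one coordinate of a point of the hypercube. -/
def flip {κ : Type*} [DecidableEq κ] (k : κ) (τ : κ → Bool) : κ → Bool :=
  Function.update τ k (!τ k)

lemma flip_involutive {κ : Type*} [DecidableEq κ] (k : κ) : Function.Involutive (flip k) := by
  intro τ
  simp [flip]

/-- For each coordinate, pair τ with its flip: being wrong at τ and being wrong at the flip are
complementary events, so the two errors sum to at least 1/2. Flipping permutes the cube, hence each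
error is counted twice. -/
lemma hypercube_lower_bound {κ Ω : Type*} [Fintype κ] [DecidableEq κ] [MeasurableSpace Ω]
    (P : (κ → Bool) → Measure Ω) (S : Finset κ) (g : Ω → κ → Bool) (hg : Measurable g)
    (htest : ∀ τ, ∀ k ∈ S, ∀ A, MeasurableSet A → 1 / 2 ≤ P τ A + P (flip k τ) Aᶜ) :
    2 ^ Fintype.card κ * (S.card / 4 : ENNReal) ≤
      ∑ τ, ∑ k ∈ S, P τ {ω | g ω k ≠ τ k} := by
  rw [Finset.sum_comm]
  have hk : ∀ k ∈ S, (2 ^ Fintype.card κ * (1 / 4) : ENNReal) ≤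
      ∑ τ, P τ {ω | g ω k ≠ τ k} := by
    intro k hk
    have h1 : ∑ τ, P (flip k τ) {ω | g ω k ≠ flip k τ k} = ∑ τ, P τ {ω | g ω k ≠ τ k} :=
      Equiv.sum_comp (flip_involutive k).toPerm fun τ => P τ {ω | g ω k ≠ τ k}
    have h2 : ∑ _τ : κ → Bool, (1 / 2 : ENNReal) ≤
        ∑ τ, (P τ {ω | g ω k ≠ τ k} + P (flip k τ) {ω | g ω k ≠ flip k τ k}) := by
      refine Finset.sum_le_sum fun τ _ => ?_
      have hA : MeasurableSet {ω | g ω k ≠ τ k} :=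
        (((measurable_pi_apply k).comp hg) (measurableSet_singleton (τ k))).compl
      have hset : {ω | g ω k ≠ flip k τ k} = {ω | g ω k ≠ τ k}ᶜ := by
        ext ω
        simp [flip]
      rw [hset]
      exact htest τ k hk _ hA
    rw [Finset.sum_add_distrib, h1, ← two_mul] at h2
    simp only [Finset.sum_const, Finset.card_univ, nsmul_eq_mul, Fintype.card_fun,
      Fintype.card_bool, Nat.cast_pow, Nat.cast_ofNat] at h2
    rw [← ENNReal.mul_le_mul_iff_right (a := 2) (by simp) (by simp)]
    refine le_trans (le_of_eq ?_) h2
    rw [mul_left_comm]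
    congr 1
    rw [show (1 / 4 : ENNReal) = ENNReal.ofReal (1 / 4) by
        rw [ENNReal.ofReal_div_of_pos (by norm_num)]; simp,
      show (1 / 2 : ENNReal) = ENNReal.ofReal (1 / 2) by
        rw [ENNReal.ofReal_div_of_pos (by norm_num)]; simp,
      show (2 : ENNReal) = ENNReal.ofReal 2 by simp, ← ENNReal.ofReal_mul (by norm_num)]
    norm_num
  calc _ = ∑ _k ∈ S, (2 ^ Fintype.card κ * (1 / 4) : ENNReal) := by
        rw [Finset.sum_const, nsmul_eq_mul]
        simp only [div_eq_mul_inv, one_mul]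
        ring
    _ ≤ _ := Finset.sum_le_sum hk

/-! ### The minimax lower bound -/

lemma half_le_dataLaw_add {N : ℕ} (hN : 1 ≤ N) {r σ : ℝ} (hσ : σ ≠ 0) (φ ψ : Fin K → ℝ)
    (h : ∫⁻ y, ENNReal.ofReal (obsDensity (r / σ) φ y ^ 2 / obsDensity (r / σ) ψ y)
      ∂(stdGaussian (Coeff K)) ≤ ENNReal.ofReal (1 + 1 / (2 * N)))
    (A : Set (Fin N → Coeff K)) (hA : MeasurableSet A) :
    1 / 2 ≤ dataLaw N σ (signal r ψ) A + dataLaw N σ (signal r φ) Aᶜ := by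
  have hmap : ∀ χ : Fin K → ℝ, dataLaw N σ (signal r χ) =
      (Measure.pi fun _ : Fin N => (stdGaussian (Coeff K)).withDensity
        fun y => ENNReal.ofReal (obsDensity (r / σ) χ y)).map fun y i => σ • y i := by
    intro χ
    have hm : ∀ _ : Fin N, AEMeasurable (fun y : Coeff K => σ • y)
        ((stdGaussian (Coeff K)).withDensity fun y => ENNReal.ofReal (obsDensity (r / σ) χ y)) := fun _ => by fun_prop
    rw [Measure.pi_map_pi hm, dataLaw, sampleLaw_signal hσ, sampleLaw_one_signal]
  have hms : Measurable fun (y : Fin N → Coeff K) i => σ • y i := by fun_prop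
  rw [hmap, hmap, Measure.map_apply hms hA, Measure.map_apply hms hA.compl, Set.preimage_compl]
  exact half_le_measure_add_measure_compl (stdGaussian (Coeff K)) N hN _ _
    (measurable_obsDensity _ φ) (measurable_obsDensity _ ψ) (obsDensity_pos _ φ)
    (obsDensity_pos _ ψ) h _ (hA.preimage hms)

/-- The phases of the hypercube point `τ`: those of the upper half of the frequencies are shifted
by `η` where `τ` is true. -/
def cubePhase (η : ℝ) (τ : Fin K → Bool) (k : Fin K) : ℝ :=
  if k ∈ upperHalf K ∧ τ k = true then η else 0

lemma cubePhase_flip_of_ne (η : ℝ) (τ : Fin K → Bool) {j k : Fin K} (h : k ≠ j) :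
    cubePhase η (flip j τ) k = cubePhase η τ k := by
  simp [cubePhase, flip, h]

lemma cubePhase_flip_sub_sq (η : ℝ) (τ : Fin K → Bool) {j : Fin K} (hj : j ∈ upperHalf K) :
    (cubePhase η (flip j τ) j - cubePhase η τ j) ^ 2 = η ^ 2 := by
  cases h : τ j <;> simp [cubePhase, flip, h, hj]

lemma sq_le_two_sub_two_cos {η : ℝ} (hη : η ^ 2 ≤ 1) : 2 / 5 * η ^ 2 ≤ 2 - 2 * Real.cos η := by
  have h1 : |η| ≤ 1 := abs_le_one_iff_mul_self_le_one.2 (by nlinarith)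
  have h := (abs_le.1 (Real.cos_bound h1)).2
  have h2 : |η| ^ 4 ≤ η ^ 2 := by
    rw [show |η| ^ 4 = (|η| ^ 2) ^ 2 by ring, sq_abs]
    nlinarith [sq_nonneg η]
  nlinarith [sq_nonneg η]

/-- The constant is 1/55 = (2/5)/22, from `sq_le_two_sub_two_cos` and
`sum_upperHalf_le_sum_rotated`. -/
lemma rotated_cube_separation {r η : ℝ} (hη : η ^ 2 ≤ 1) (τ τ' : Fin K → Bool) (α β : ℝ) :
    r ^ 2 * η ^ 2 / 55 * ((upperHalf K).filter fun k => τ' k ≠ τ k).card ≤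
      ‖rotate α (signal r (cubePhase η τ)) - rotate β (signal r (cubePhase η τ'))‖ ^ 2 := by
  rw [rotate_signal, rotate_signal, norm_signal_sub_sq]
  simp only [rotatePhase_sub]
  have h := sum_upperHalf_le_sum_rotated
    (fun k => cubePhase η τ k - cubePhase η τ' k) (fun k hk => by simp [cubePhase, hk]) (α - β)
  have h2 : ((upperHalf K).filter fun k => τ' k ≠ τ k).card * (2 / 5 * η ^ 2) ≤
      ∑ k ∈ upperHalf K, (2 - 2 * Real.cos (cubePhase η τ k - cubePhase η τ' k)) := by
    rw [← nsmul_eq_mul, ← Finset.sum_const, Finset.sum_filter]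
    refine Finset.sum_le_sum fun k hk => ?_
    have h3 := sq_le_two_sub_two_cos hη
    cases hτ : τ k <;> cases hτ' : τ' k <;> simp [cubePhase, hk, hτ, hτ'] <;> linarith
  have h4 : 0 ≤ r ^ 2 := sq_nonneg r
  have h5 := h2.trans h
  calc _ = r ^ 2 * ((((upperHalf K).filter fun k => τ' k ≠ τ k).card * (2 / 5 * η ^ 2)) / 22) := by
        ring
    _ ≤ _ := by
        gcongr
        linarith

lemma le_minimaxRisk {N : ℕ} (hK : 2 ≤ K) (hN : 1 ≤ N) {r σ η : ℝ} (hr : 0 < r) (hσ : 0 < σ)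
    (hη : η ^ 2 ≤ 1)
    (h : ∀ (φ ψ : Fin K → ℝ) (j : Fin K), (∀ k ≠ j, φ k = ψ k) → (φ j - ψ j) ^ 2 = η ^ 2 →
      ∫⁻ y, ENNReal.ofReal (obsDensity (r / σ) φ y ^ 2 / obsDensity (r / σ) ψ y)
        ∂(stdGaussian (Coeff K)) ≤ ENNReal.ofReal (1 + 1 / (2 * N))) :
    ENNReal.ofReal (K * r ^ 2 * η ^ 2 / 2640) ≤ minimaxRisk K N σ r := by
  refine le_iInf fun ⟨est, hest⟩ => ?_
  obtain ⟨g, hg, hmin⟩ := exists_measurable_argmin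
    (fun τ : Fin K → Bool => loss (signal r (cubePhase η τ))) fun τ => measurable_loss _
  set P : (Fin K → Bool) → Measure (Fin N → Coeff K) :=
    fun τ => dataLaw N σ (signal r (cubePhase η τ)) with hP
  -- Loss per wrong coordinate: separation 1/55 divided by the 4 of `le_four_mul_loss`.
  set c : ℝ := r ^ 2 * η ^ 2 / 220 with hc
  have hc0 : 0 ≤ c := by positivity
  have hcube := hypercube_lower_bound P (upperHalf K) (fun y => g (est y)) (hg.comp hest)
    fun τ j hj A hA => half_le_dataLaw_add hN hσ.ne' _ _
      (h _ _ j (fun k hk => cubePhase_flip_of_ne η τ hk) (cubePhase_flip_sub_sq η τ hj)) A hA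
  have hmeas : ∀ (τ : Fin K → Bool) (k : Fin K), MeasurableSet {y | g (est y) k ≠ τ k} :=
    fun τ k => (((measurable_pi_apply k).comp (hg.comp hest))
      (measurableSet_singleton (τ k))).compl
  have hrisk : ∀ τ, ENNReal.ofReal c * ∑ k ∈ upperHalf K, P τ {y | g (est y) k ≠ τ k} ≤
      risk N σ est (signal r (cubePhase η τ)) := by
    intro τ
    have hsum : ∑ k ∈ upperHalf K, P τ {y | g (est y) k ≠ τ k} =
        ∫⁻ y, ((upperHalf K).filter fun k => g (est y) k ≠ τ k).card ∂(P τ) := by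
      have : ∀ y, (((upperHalf K).filter fun k => g (est y) k ≠ τ k).card : ENNReal) =
          ∑ k ∈ upperHalf K, {y | g (est y) k ≠ τ k}.indicator 1 y := by
        intro y
        rw [Finset.card_filter]
        push_cast
        exact Finset.sum_congr rfl fun k _ => by simp [Set.indicator_apply]
      simp_rw [this]
      rw [lintegral_finsetSum _ fun k _ => measurable_one.indicator (hmeas τ k)]
      exact Finset.sum_congr rfl fun k _ => (lintegral_indicator_one (hmeas τ k)).symm
    rw [hsum, ← lintegral_const_mul' _ _ ENNReal.ofReal_ne_top]
    refine lintegral_mono fun y => ?_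
    rw [← ENNReal.ofReal_natCast, ← ENNReal.ofReal_mul hc0]
    refine ENNReal.ofReal_le_ofReal ?_
    have := le_four_mul_loss (rotated_cube_separation (r := r) hη τ (g (est y))) (hmin (est y) τ)
    rw [hc]
    linarith
  set R := ⨆ θ : paramSpace K r, risk N σ est θ.1 with hR
  have hle : ∀ τ, risk N σ est (signal r (cubePhase η τ)) ≤ R := fun τ =>
    le_iSup (fun θ : paramSpace K r => risk N σ est θ.1)
      ⟨signal r (cubePhase η τ), signal_mem_paramSpace hr.le _⟩
  have hfinal : (2 : ENNReal) ^ K * (ENNReal.ofReal c * ((upperHalf K).card / 4)) ≤ 2 ^ K * R := by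
    calc _ = ENNReal.ofReal c *
          (2 ^ Fintype.card (Fin K) * ((upperHalf K).card / 4 : ENNReal)) := by
          rw [Fintype.card_fin]; ring
      _ ≤ ENNReal.ofReal c * ∑ τ, ∑ k ∈ upperHalf K, P τ {y | g (est y) k ≠ τ k} := by gcongr
      _ = ∑ τ, ENNReal.ofReal c * ∑ k ∈ upperHalf K, P τ {y | g (est y) k ≠ τ k} :=
          Finset.mul_sum _ _ _
      _ ≤ ∑ _τ : Fin K → Bool, R := Finset.sum_le_sum fun τ _ => (hrisk τ).trans (hle τ)
      _ = 2 ^ K * R := by simp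
  have hR' := (ENNReal.mul_le_mul_iff_right (by simp) (by simp)).1 hfinal
  refine le_trans ?_ hR'
  have h4 : ((upperHalf K).card / 4 : ENNReal) = ENNReal.ofReal ((K / 2 : ℕ) / 4) := by
    rw [card_upperHalf, ENNReal.ofReal_div_of_pos (by norm_num), ENNReal.ofReal_natCast]
    simp
  rw [h4, ← ENNReal.ofReal_mul hc0]
  refine ENNReal.ofReal_le_ofReal ?_
  -- Floor division: K = 3 is the extreme case, and K ≥ 2 is needed. Then 2640 = 220·4·3.
  have hK3 : (K : ℝ) / 3 ≤ (K / 2 : ℕ) := by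
    have : K ≤ 3 * (K / 2) := by omega
    have : (K : ℝ) ≤ 3 * (K / 2 : ℕ) := by exact_mod_cast this
    linarith
  calc _ = c * ((K : ℝ) / 3 / 4) := by rw [hc]; ring
    _ ≤ _ := by gcongr

lemma low_noise_lower_bound {N : ℕ} (hK : 2 ≤ K) (hN : 1 ≤ N) {r σ : ℝ} (hr : 0 < r)
    (hσ : 0 < σ) :
    ENNReal.ofReal (1 / 120000 * min ((K : ℝ) * σ ^ 2 / N) (K * r ^ 2)) ≤
      minimaxRisk K N σ r := by
  have hN' : (1 : ℝ) ≤ N := by exact_mod_cast hN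
  have hK' : (2 : ℝ) ≤ K := by exact_mod_cast hK
  set t := (r / σ) ^ 2 with ht
  have ht0 : 0 < t := by positivity
  -- The squared step η². It gives tη² ≤ 1/(4N), and e^x ≤ 1 + 2x at x = 1/(4N) meets the χ² budget
  -- 1/(2N).
  set q : ℝ := min 1 (1 / (N * t)) / 4 with hq
  have hmin0 : (0 : ℝ) ≤ min 1 (1 / (N * t)) := le_min zero_le_one (by positivity)
  have hq0 : 0 ≤ q := by positivity
  have hη : Real.sqrt q ^ 2 = q := Real.sq_sqrt hq0
  have hq1 : q ≤ 1 := by linarith [min_le_left (1 : ℝ) (1 / (N * t))]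
  have htq : t * q ≤ 1 / (4 * N) := by
    calc t * q ≤ t * (1 / (N * t) / 4) := by
          rw [hq]
          gcongr
          exact min_le_right _ _
      _ = 1 / (4 * N) := by field_simp
  have h := le_minimaxRisk (η := Real.sqrt q) hK hN hr hσ (hη.trans_le hq1)
    fun φ ψ j hφψ hj => by
      refine (lintegral_obsDensity_sq_div_le _ φ ψ).trans (ENNReal.ofReal_le_ofReal ?_)
      rw [Finset.sum_eq_single j (fun k _ hk => by simp [hφψ k hk]) (by simp), ← ht]
      have h1 : 2 - 2 * Real.cos (φ j - ψ j) ≤ q := by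
        rw [hη] at hj
        linarith [Real.one_sub_sq_div_two_le_cos (x := φ j - ψ j)]
      have h2 : t * (2 - 2 * Real.cos (φ j - ψ j)) ≤ 1 / (4 * N) :=
        (mul_le_mul_of_nonneg_left h1 ht0.le).trans htq
      set x : ℝ := 1 / (4 * N) with hx
      have hx0 : 0 ≤ x := by positivity
      have hx1 : x ≤ 1 / 4 := by
        rw [hx]
        gcongr
        linarith
      have h3 := (abs_le.1 (Real.abs_exp_sub_one_sub_id_le
        (abs_le.2 ⟨by linarith, by linarith⟩ : |x| ≤ 1))).2
      have h4 : 1 / (2 * (N : ℝ)) = 2 * x := by rw [hx]; field_simp; norm_num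
      rw [h4]
      calc _ ≤ Real.exp x := Real.exp_le_exp.2 h2
        _ ≤ 1 + 2 * x := by nlinarith
  refine le_trans (ENNReal.ofReal_le_ofReal ?_) h
  have e1 : (K : ℝ) * σ ^ 2 / N = K * r ^ 2 * (1 / (N * t)) := by
    rw [ht]
    field_simp
  have e2 : min ((K : ℝ) * σ ^ 2 / N) (K * r ^ 2) = K * r ^ 2 * min 1 (1 / (N * t)) := by
    rw [e1, min_comm, mul_min_of_nonneg _ _ (by positivity), mul_one]
  rw [e2, hη, hq]
  have : 0 ≤ K * r ^ 2 * min 1 (1 / (N * t)) := by positivity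
  linarith

lemma high_noise_lower_bound {N : ℕ} (hK : 2 ≤ K) (hN : 1 ≤ N) {r σ : ℝ} (hr : 0 < r)
    (hσ : 0 < σ)
    (h : (K : ℝ) * σ ^ 2 / N ≤
      σ ^ 6 / ((N : ℝ) * r ^ 4 * Real.exp (3 * (K : ℝ) * r ^ 2 / (2 * σ ^ 2)))) :
    ENNReal.ofReal (1 / 120000 * min
      (σ ^ 6 / ((N : ℝ) * r ^ 4 * Real.exp (3 * (K : ℝ) * r ^ 2 / (2 * σ ^ 2)))) (K * r ^ 2)) ≤
      minimaxRisk K N σ r := by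
  have hN' : (1 : ℝ) ≤ N := by exact_mod_cast hN
  have hK' : (2 : ℝ) ≤ K := by exact_mod_cast hK
  set t := (r / σ) ^ 2 with ht
  have ht0 : 0 < t := by positivity
  have hexp : 3 * (K : ℝ) * r ^ 2 / (2 * σ ^ 2) = 3 * K * t / 2 := by
    rw [ht]
    field_simp
  rw [hexp] at h ⊢
  set E := Real.exp (3 * K * t / 2) with hE
  have hE0 : 0 < E := Real.exp_pos _
  -- The hypothesis that the second term dominates, rewritten in t.
  have hKt : K * t ^ 2 * E ≤ 1 := by
    have e : σ ^ 6 / ((N : ℝ) * r ^ 4 * E) * (K * t ^ 2 * E) = K * σ ^ 2 / N := by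
      rw [ht]
      field_simp
    have hpos : 0 < σ ^ 6 / ((N : ℝ) * r ^ 4 * E) := by positivity
    rw [← e] at h
    exact (mul_le_iff_le_one_right hpos).1 h
  -- Were t > 1/2, then K ≥ 2 would give E ≥ 5/2 and Kt² ≥ 1/2, with product above 1.
  have ht' : t ≤ 1 / 2 := by
    by_contra! hcon
    have h1 : 3 * K * t / 2 + 1 ≤ E := Real.add_one_le_exp _
    have h2 : 5 / 2 ≤ E := by nlinarith
    have h3 : 1 / 2 ≤ K * t ^ 2 := by nlinarith
    nlinarith
  -- The divisor 44 turns the factor 22 of the χ² bound into the budget 1/(2N).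
  set q : ℝ := min 1 (1 / (N * K * t ^ 3 * E)) / 44 with hq
  have hmin0 : (0 : ℝ) ≤ min 1 (1 / (N * K * t ^ 3 * E)) := le_min zero_le_one (by positivity)
  have hq0 : 0 ≤ q := by positivity
  have hη : Real.sqrt q ^ 2 = q := Real.sq_sqrt hq0
  have hq1 : q ≤ 1 := by linarith [min_le_left (1 : ℝ) (1 / (N * K * t ^ 3 * E))]
  have hmain := le_minimaxRisk (η := Real.sqrt q) hK hN hr hσ (hη.trans_le hq1)
    fun φ ψ j hφψ hj => by
      refine (lintegral_obsDensity_sq_div_le_of_eq_off ht' j hφψ).trans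
        (ENNReal.ofReal_le_ofReal ?_)
      rw [hj, hη, ← ht, ← hE, show (r / σ) ^ 6 = t ^ 3 by rw [ht]; ring]
      gcongr
      calc 22 * t ^ 3 * (K : ℝ) * q * E ≤
            22 * t ^ 3 * K * (1 / ((N : ℝ) * K * t ^ 3 * E) / 44) * E := by
            rw [hq]
            gcongr
            exact min_le_right _ _
        _ = 1 / (2 * (N : ℝ)) := by
            field_simp
            norm_num
  refine le_trans (ENNReal.ofReal_le_ofReal ?_) hmain
  have e1 : σ ^ 6 / ((N : ℝ) * r ^ 4 * E) = K * r ^ 2 * (1 / (N * K * t ^ 3 * E)) := by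
    rw [ht]
    field_simp
  have e2 : min (σ ^ 6 / ((N : ℝ) * r ^ 4 * E)) (K * r ^ 2) =
      K * r ^ 2 * min 1 (1 / (N * K * t ^ 3 * E)) := by
    rw [e1, min_comm, mul_min_of_nonneg _ _ (by positivity), mul_one]
  rw [e2, hη, hq]
  have : 0 ≤ K * r ^ 2 * min 1 (1 / (N * K * t ^ 3 * E)) := by positivity
  linarith

end OrbitEstimation

end

theorem lemma11 :
    ∃ c : ℝ, 0 < c ∧
      ∀ (K N : ℕ) (r σ : ℝ), 2 ≤ K → 1 ≤ N → 0 < r → 0 < σ →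
        ENNReal.ofReal
            (c * min
              (max ((K : ℝ) * σ ^ 2 / (N : ℝ))
                (σ ^ 6 / ((N : ℝ) * r ^ 4 * Real.exp (3 * (K : ℝ) * r ^ 2 / (2 * σ ^ 2)))))
              ((K : ℝ) * r ^ 2))
          ≤ OrbitEstimation.minimaxRisk K N σ r := by
  -- The worse of the two regimes costs 44·2640 = 116160.
  refine ⟨1 / 120000, by norm_num, fun K N r σ hK hN hr hσ => ?_⟩
  rcases le_total ((K : ℝ) * σ ^ 2 / N)
    (σ ^ 6 / ((N : ℝ) * r ^ 4 * Real.exp (3 * (K : ℝ) * r ^ 2 / (2 * σ ^ 2)))) with h | h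
  · rw [max_eq_right h]
    exact OrbitEstimation.high_noise_lower_bound hK hN hr hσ h
  · rw [max_eq_left h]
    exact OrbitEstimation.low_noise_lower_bound hK hN hr hσ
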